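/- **Setting.** Let $G$ be a finite multigraph (loops and parallel edges allowed) with at least one vertex and with maximum degree at most three (a loop counts twice in the degree of its vertex), with real edge costs, and let $F$ be a set of edges of $G$, the *forced* edges; the other edges are *unforced*. A *cycle* of length $k\ge 1$ consists of $k$ distinct vertices $v_1,\dots,v_k$ and $k$ distinct edges $e_1,\dots,e_k$, where $e_i$ joins $v_i$ to $v_{i+1}$ (indices mod $k$); so a loop is a cycle of length 1 and two parallel edges form a cycle of length 2. It is *Hamiltonian* if it contains all vertices of $G$. A *tour* of $(G,F)$ is a Hamiltonian cycle of $G$ that contains all edges of $F$; its weight is the sum of the costs of its edges. **Algorithm.** Consider the following nondeterministic recursive algorithm on $(G,F)$ with the given costs. 1. Repeat the following steps until one of them returns or none of them applies. (Steps (b) and (j) apply only if they add a new edge to $F$.) When several steps apply, or one step applies at several places, any of them may be chosen, except that step (i) is performed only if none of (a)–(h) applies. - (a) If $G$ contains a vertex of degree zero or one, return None. - (b) If $G$ contains a vertex of degree two, add its incident edges to $F$. - (c) If $F$ is the edge set of a Hamiltonian cycle of $G$, return its cost. - (d) If $F$ contains a cycle that is not Hamiltonian, return None. - (e) If $F$ contains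 three edges meeting at a vertex, return None. - (f) If $F$ contains exactly two edges meeting at some vertex (neither being a loop), remove from $G$ that vertex and any other edge incident to it, and replace the two edges by a single forced edge connecting their other two endpoints, whose cost is the sum of the two costs. - (g) If $G$ has more than two vertices and contains two parallel edges that are not both in $F$, remove an unforced one of them; if both are unforced, remove one whose cost is at least that of the other. - (h) If $G$ has more than one vertex and contains a loop that is not in $F$, remove it. - (i) If $G$ contains a triangle $xyz$, then for each non-triangle edge $e$ incident to a triangle vertex, increase the cost of $e$ by the cost of the opposite triangle edge (the one not containing that vertex), and add $e$ to $F$ if that triangle edge is in $F$. Then remove the three triangle edges and merge $x,y,z$ into one vertex. - (j) If $G$ contains a cycle of four unforced edges, two opposite vertices of which are each incident to a forced edge, add to $F$ all non-cycle edges that are incident to a vertex of the cycle. 2. If the unforced edges form a collection of vertex-disjoint 4-cycles $C_1,\dots,C_m$: let $H_i$ be a pair of opposite edges of $C_i$ with $\mathrm{cost}(H_i)\le\mathrm{cost}(C_i\setminus H_i)$, and let $H=\bigcup_i H_i$. Form the multigraph $G'$ whose vertices are the connected components of $F\cup H$ (on the vertex set of $G$), with one edge of cost $\mathrm{cost}(C_i\setminus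 H_i)-\mathrm{cost}(H_i)$ for each $i$ such that the two edges of $H_i$ lie in different components, joining these two components. Return the sum of $\mathrm{cost}(F\cup H)$ and the cost of a minimum spanning tree of $G'$, or None if $G'$ has no spanning tree. 3. Otherwise choose an edge $f$: - (a) if there is a 4-cycle of unforced edges exactly two vertices of which are incident to edges of $F$, take any such cycle and let $f$ be an unforced edge that does not belong to this cycle and is incident to one of its other two vertices; - (b) if there is no such 4-cycle but $F\neq\emptyset$, let $f$ be an unforced edge that shares an endpoint with an edge of $F$; - (c) if $F=\emptyset$, let $f$ be any edge of $G$. 4. Call the algorithm recursively on $(G,F\cup\{f\})$. 5. Call the algorithm recursively on $(G\setminus\{f\},F)$. 6. Return the minimum of the (at most two) numbers returned by the recursive calls, or None if both calls return None. **Theorem.** For every such $G$, $F$ and costs, and for all choices made during the execution, the algorithm terminates (no execution is infinite, and an execution can stop only by returning a value), and it returns the minimum weight of a tour of $(G,F)$, or None if there is no tour. -/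

import Mathlib

open scoped Graph

namespace ForcedTSP

universe u v

section Multigraphs

variable {α : Type u} {β : Type v}

/-- The degree of a vertex of a finite multigraph; a loop counts twice. -/
noncomputable def degree (G : Graph α β) (x : α) : ℕ :=
  (G.incidenceSet x).ncard + (G.loopSet x).ncard

/-- `w` and `e` list the vertices and the edges of a cycle of length `k ≥ 1` of `G`, in cyclic order
(the addition in `Fin k` wraps around). A loop is a cycle of length 1, and two parallel edges form
a cycle of length 2. -/
def IsCycle {k : ℕ} [NeZero k] (G : Graph α β) (w : Fin k → α) (e : Fin k → β) : Prop :=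
  Function.Injective w ∧ Function.Injective e ∧ ∀ i, G.IsLink (e i) (w i) (w (i + 1))

/-- `C` is the edge set of a Hamiltonian cycle of `G`. -/
def IsHamiltonianCycle (G : Graph α β) (C : Set β) : Prop :=
  ∃ (k : ℕ) (_ : NeZero k) (w : Fin k → α) (e : Fin k → β),
    IsCycle G w e ∧ Set.range w = V(G) ∧ Set.range e = C

/-- The vertex set of the connected component of `x`. -/
def component (G : Graph α β) (x : α) : Set α :=
  {y | Relation.ReflTransGen G.Adj x y}

/-- `T` is the edge set of a spanning tree of `G`. -/
def IsSpanningTree (G : Graph α β) (T : Set β) : Prop :=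
  T ⊆ E(G) ∧ V(G).Nonempty ∧
    (∀ x ∈ V(G), ∀ y ∈ V(G), y ∈ component (G.restrict T) x) ∧
    ∀ (k : ℕ) [NeZero k] (w : Fin k → α) (e : Fin k → β), ¬ IsCycle (G.restrict T) w e

/-- The total cost of a finite set of edges. -/
noncomputable def totalCost (c : β → ℝ) (C : Set β) : ℝ := ∑ᶠ f ∈ C, c f

/-- `T` is the edge set of a spanning tree of `G` of minimum total cost. -/
def IsMinSpanningTree (G : Graph α β) (c : β → ℝ) (T : Set β) : Prop :=
  IsSpanningTree G T ∧ ∀ T', IsSpanningTree G T' → totalCost c T ≤ totalCost c T'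

end Multigraphs

/-- An instance of the forced traveling salesman problem: a multigraph, a set of forced edges,
and edge costs (only the costs of the edges of the graph matter). -/
structure Problem (α : Type u) (β : Type v) where
  graph : Graph α β
  forced : Set β
  cost : β → ℝ

section Algorithm

variable {α : Type u} {β : Type v}

/-- `C` is a Hamiltonian cycle that contains all forced edges. -/
def Problem.IsTour (P : Problem α β) (C : Set β) : Prop :=
  IsHamiltonianCycle P.graph C ∧ P.forced ⊆ C

/-- `r` is the correct answer: the minimum cost of a tour, or `none` if there is no tour. -/
def Problem.IsOptimum (P : Problem α β) : Option ℝ → Prop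
  | none => ∀ C, ¬ P.IsTour C
  | some t => IsLeast {s | ∃ C, P.IsTour C ∧ s = totalCost P.cost C} t

/-- Add the edges in `A` to the forced edges. -/
def Problem.force (P : Problem α β) (A : Set β) : Problem α β :=
  { P with forced := P.forced ∪ A }

/-- Remove the edge `f` from the graph. -/
def Problem.delete (P : Problem α β) (f : β) : Problem α β :=
  { P with graph := P.graph.deleteEdges {f} }

open Classical in
/-- Contraction of the two forced edges `e₁ = xa` and `e₂ = xb`. All edges at `x` other than `e₁` are
deleted and the end `x` of `e₁` is moved to `b`. So `x` disappears, and the label `e₁` is used again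
for the new forced edge `ab`, whose cost is the sum of the two costs. -/
noncomputable def Problem.contractPath (P : Problem α β) (x b : α) (e₁ e₂ : β) : Problem α β where
  graph := (P.graph.deleteEdges (P.graph.incidenceSet x \ {e₁})).map
    (fun y => if y = x then b else y)
  forced := P.forced \ {e₂}
  cost := Function.update P.cost e₁ (P.cost e₁ + P.cost e₂)

open Classical in
/-- The Delta-Y step for the triangle with vertices `w 0, w 1, w 2` and edges `e i` from `w i` to
`w (i + 1)`, so that `e (i + 1)` is opposite to `w i`. The triangle edges are deleted and the three
vertices are merged into one, for which the name `w 0` is used again. -/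
noncomputable def Problem.contractTriangle (P : Problem α β) (w : Fin 3 → α) (e : Fin 3 → β) :
    Problem α β where
  graph := (P.graph.deleteEdges (Set.range e)).map
    (fun y => if y ∈ Set.range w then w 0 else y)
  forced := (P.forced ∪ {f | ∃ i, P.graph.Inc f (w i) ∧ e (i + 1) ∈ P.forced}) \ Set.range e
  cost := fun f => P.cost f + ∑ i, if P.graph.Inc f (w i) then P.cost (e (i + 1)) else 0

/-- The configurations of the algorithm: a call on a problem that is still to be processed, a pair
of recursive calls in progress, or a returned value (`none` for the special value "None"). -/
inductive Config (α : Type u) (β : Type v) : Type (max u v)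
  | call (P : Problem α β)
  | fork (first second : Config α β)
  | ret (r : Option ℝ)

/-- The simplification steps (a)-(h): `Reduce P c` means that one of these steps applies to `P`
and that performing it, for some choice of the place where it is performed, leads to `c`. -/
inductive Reduce (P : Problem α β) : Config α β → Prop
  /-- (a) A vertex of degree zero or one. -/
  | lowDegree (x : α) (hx : x ∈ V(P.graph)) (hd : degree P.graph x ≤ 1) : Reduce P (.ret none)
  /-- (b) A vertex of degree two, not all of whose incident edges are forced yet. -/
  | degreeTwo (x : α) (hx : x ∈ V(P.graph)) (hd : degree P.graph x = 2)
      (hnew : ¬ P.graph.incidenceSet x ⊆ P.forced) :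
      Reduce P (.call (P.force (P.graph.incidenceSet x)))
  /-- (c) The forced edges form a Hamiltonian cycle. -/
  | hamiltonian (h : IsHamiltonianCycle P.graph P.forced) :
      Reduce P (.ret (some (totalCost P.cost P.forced)))
  /-- (d) The forced edges contain a non-Hamiltonian cycle. -/
  | nonHamiltonian (k : ℕ) [NeZero k] (w : Fin k → α) (e : Fin k → β) (h : IsCycle P.graph w e)
      (hF : Set.range e ⊆ P.forced) (hne : Set.range w ≠ V(P.graph)) : Reduce P (.ret none)
  /-- (e) Three forced edges meeting at a vertex. -/
  | claw (x : α) (h : 3 ≤ (P.graph.incidenceSet x ∩ P.forced).ncard) : Reduce P (.ret none)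
  /-- (f) Exactly two forced edges meeting at a vertex `x`, with other endpoints `a` and `b`. -/
  | path (x a b : α) (e₁ e₂ : β) (hne : e₁ ≠ e₂) (ha : a ≠ x) (hb : b ≠ x)
      (h₁ : P.graph.IsLink e₁ x a) (h₂ : P.graph.IsLink e₂ x b)
      (h : P.graph.incidenceSet x ∩ P.forced = {e₁, e₂}) :
      Reduce P (.call (P.contractPath x b e₁ e₂))
  /-- (g) Two parallel edges, not both forced, in a graph with more than two vertices: an unforced
  one is removed, and if both are unforced, one that is not cheaper than the other. -/
  | parallel (x y : α) (f g : β) (hne : f ≠ g) (hf : P.graph.IsLink f x y)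
      (hg : P.graph.IsLink g x y) (hV : 2 < V(P.graph).ncard) (hfF : f ∉ P.forced)
      (h : g ∈ P.forced ∨ P.cost g ≤ P.cost f) : Reduce P (.call (P.delete f))
  /-- (h) An unforced loop in a graph with more than one vertex. -/
  | loop (x : α) (f : β) (hf : P.graph.IsLoopAt f x) (hfF : f ∉ P.forced)
      (hV : 1 < V(P.graph).ncard) : Reduce P (.call (P.delete f))

/-- A cycle of four unforced edges. -/
def Problem.IsUnforcedQuad (P : Problem α β) (w : Fin 4 → α) (e : Fin 4 → β) : Prop :=
  IsCycle P.graph w e ∧ ∀ i, e i ∉ P.forced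

/-- The vertex `x` is incident to a forced edge. -/
def Problem.Touched (P : Problem α β) (x : α) : Prop := ∃ f ∈ P.forced, P.graph.Inc f x

/-- The edges of the graph that are incident to a vertex of the given 4-cycle but do not belong
to it. -/
def Problem.outerEdges (P : Problem α β) (w : Fin 4 → α) (e : Fin 4 → β) : Set β :=
  {f | (∃ i, P.graph.Inc f (w i)) ∧ f ∉ Set.range e}

/-- All simplification steps. The triangle contraction is performed only when none of the steps
(a)-(h) applies; apart from this, an applicable step may be chosen arbitrarily. -/
inductive Simplify (P : Problem α β) : Config α β → Prop
  /-- (a)-(h) -/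
  | reduce (c : Config α β) (h : Reduce P c) : Simplify P c
  /-- (i) A triangle. -/
  | triangle (hfirst : ∀ c, ¬ Reduce P c) (w : Fin 3 → α) (e : Fin 3 → β)
      (h : IsCycle P.graph w e) : Simplify P (.call (P.contractTriangle w e))
  /-- (j) A cycle of four unforced edges with two opposite vertices incident to forced edges, such
  that not all non-cycle edges at the cycle are forced yet. -/
  | quad (w : Fin 4 → α) (e : Fin 4 → β) (h : P.IsUnforcedQuad w e)
      (h₀ : P.Touched (w 0)) (h₂ : P.Touched (w 2)) (hnew : ¬ P.outerEdges w e ⊆ P.forced) :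
      Simplify P (.call (P.force (P.outerEdges w e)))

/-- The unforced edges form the collection of the vertex-disjoint 4-cycles `(w i, e i)`. -/
def Problem.IsQuadCollection (P : Problem α β) {m : ℕ} (w : Fin m → Fin 4 → α)
    (e : Fin m → Fin 4 → β) : Prop :=
  (∀ i, IsCycle P.graph (w i) (e i)) ∧
    (∀ i j, i ≠ j → Disjoint (Set.range (w i)) (Set.range (w j))) ∧
    (⋃ i, Set.range (e i)) = E(P.graph) \ P.forced

/-- The union of the pairs `H i = {e i 0, e i 2}` of opposite edges. -/
def halves {m : ℕ} (e : Fin m → Fin 4 → β) : Set β := ⋃ i, {e i 0, e i 2}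

/-- The patch graph: its vertices are the connected components of the subgraph formed by the forced
edges and the pairs `H i`; for each `i` such that the two edges of `H i` (one at `w i 0`, the other
at `w i 2`) lie in different components there is an edge `i` between these components. -/
def Problem.patchGraph (P : Problem α β) {m : ℕ} (w : Fin m → Fin 4 → α)
    (e : Fin m → Fin 4 → β) : Graph (Set α) (Fin m) where
  vertexSet := component (P.graph.restrict (P.forced ∪ halves e)) '' V(P.graph)
  IsLink i A B :=
    A ∈ component (P.graph.restrict (P.forced ∪ halves e)) '' V(P.graph) ∧
    B ∈ component (P.graph.restrict (P.forced ∪ halves e)) '' V(P.graph) ∧ A ≠ B ∧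
    ((w i 0 ∈ A ∧ w i 2 ∈ B) ∨ (w i 0 ∈ B ∧ w i 2 ∈ A))
  isLink_symm := by
    intro i _
    refine ⟨fun A B h => ⟨h.2.1, h.1, h.2.2.1.symm, h.2.2.2.symm⟩⟩
  eq_or_eq_of_isLink_of_isLink := by
    have symm : ∀ x y, y ∈ component (P.graph.restrict (P.forced ∪ halves e)) x →
        x ∈ component (P.graph.restrict (P.forced ∪ halves e)) y := by
      intro x y h
      exact Relation.ReflTransGen.stdSymm.symm _ _ h
    have key : ∀ A ∈ component (P.graph.restrict (P.forced ∪ halves e)) '' V(P.graph),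
        ∀ B ∈ component (P.graph.restrict (P.forced ∪ halves e)) '' V(P.graph),
        ∀ z, z ∈ A → z ∈ B → A = B := by
      rintro _ ⟨x, _, rfl⟩ _ ⟨y, _, rfl⟩ z hx hy
      ext t
      exact ⟨fun ht => (hy.trans (symm _ _ hx)).trans ht,
        fun ht => (hx.trans (symm _ _ hy)).trans ht⟩
    rintro i A B C D ⟨hA, hB, _, h⟩ ⟨hC, hD, _, h'⟩
    rcases h with h | h <;> rcases h' with h' | h'
    · exact Or.inl (key A hA C hC _ h.1 h'.1)
    · exact Or.inr (key A hA D hD _ h.1 h'.1)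
    · exact Or.inr (key A hA D hD _ h.2 h'.2)
    · exact Or.inl (key A hA C hC _ h.2 h'.2)
  left_mem_of_isLink := fun _ _ _ h => h.1

/-- The cost of the edge `i` of the patch graph: the cost of the two edges of the `i`-th 4-cycle
outside `H i` minus the cost of `H i`. -/
def Problem.patchCost (P : Problem α β) {m : ℕ} (e : Fin m → Fin 4 → β) (i : Fin m) : ℝ :=
  (P.cost (e i 1) + P.cost (e i 3)) - (P.cost (e i 0) + P.cost (e i 2))

/-- The step for the case that the unforced edges form disjoint 4-cycles: `Patch P r` means that
this case applies to `P` and that `r` is returned for some way of listing the cycles so that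
`H i = {e i 0, e i 2}` is not more expensive than the rest of the `i`-th cycle. -/
inductive Patch (P : Problem α β) : Option ℝ → Prop
  | tree {m : ℕ} (w : Fin m → Fin 4 → α) (e : Fin m → Fin 4 → β) (h : P.IsQuadCollection w e)
      (hH : ∀ i, P.cost (e i 0) + P.cost (e i 2) ≤ P.cost (e i 1) + P.cost (e i 3))
      (T : Set (Fin m)) (hT : IsMinSpanningTree (P.patchGraph w e) (P.patchCost e) T) :
      Patch P (some (totalCost P.cost (P.forced ∪ halves e) + totalCost (P.patchCost e) T))
  | noTree {m : ℕ} (w : Fin m → Fin 4 → α) (e : Fin m → Fin 4 → β) (h : P.IsQuadCollection w e)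
      (hH : ∀ i, P.cost (e i 0) + P.cost (e i 2) ≤ P.cost (e i 1) + P.cost (e i 3))
      (hT : ∀ T, ¬ IsSpanningTree (P.patchGraph w e) T) : Patch P none

/-- A 4-cycle of unforced edges, exactly two vertices of which are incident to forced edges. -/
def Problem.IsBranchQuad (P : Problem α β) (w : Fin 4 → α) (e : Fin 4 → β) : Prop :=
  P.IsUnforcedQuad w e ∧ {i | P.Touched (w i)}.ncard = 2

/-- The edges that may be chosen for branching. -/
inductive BranchEdge (P : Problem α β) : β → Prop
  /-- An unforced edge leaving such a 4-cycle at one of the other two vertices. -/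
  | quad (w : Fin 4 → α) (e : Fin 4 → β) (h : P.IsBranchQuad w e) (i : Fin 4)
      (hi : ¬ P.Touched (w i)) (f : β) (hf : P.graph.Inc f (w i)) (hfF : f ∉ P.forced)
      (hfe : f ∉ Set.range e) : BranchEdge P f
  /-- Without such a 4-cycle, an unforced edge that shares an endpoint `y` with a forced edge. -/
  | forced (hno : ∀ w e, ¬ P.IsBranchQuad w e) (g : β) (y : α) (hgF : g ∈ P.forced)
      (hg : P.graph.Inc g y) (f : β) (hf : P.graph.Inc f y) (hfF : f ∉ P.forced) : BranchEdge P f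
  /-- Any edge, if there are no forced edges. -/
  | initial (hF : P.forced = ∅) (f : β) (hf : f ∈ E(P.graph)) : BranchEdge P f

/-- One step of an execution of the algorithm. Simplification steps are performed as long as one
applies; then the 4-cycle case is tested; then the algorithm branches. The two recursive calls are
executed one after the other, and then the minimum of the at most two returned numbers is
returned. -/
inductive Step : Config α β → Config α β → Prop
  | simplify (P : Problem α β) (c : Config α β) (h : Simplify P c) : Step (.call P) c
  | patch (P : Problem α β) (r : Option ℝ) (hs : ∀ c, ¬ Simplify P c) (h : Patch P r) :
      Step (.call P) (.ret r)
  | branch (P : Problem α β) (f : β) (hs : ∀ c, ¬ Simplify P c)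
      (hq : ∀ (m : ℕ) (w : Fin m → Fin 4 → α) (e : Fin m → Fin 4 → β), ¬ P.IsQuadCollection w e)
      (h : BranchEdge P f) :
      Step (.call P) (.fork (.call (P.force {f})) (.call (P.delete f)))
  | first (c c' d : Config α β) (h : Step c c') : Step (.fork c d) (.fork c' d)
  | second (r : Option ℝ) (d d' : Config α β) (h : Step d d') :
      Step (.fork (.ret r) d) (.fork (.ret r) d')
  | join (r s : Option ℝ) : Step (.fork (.ret r) (.ret s)) (.ret (Option.merge min r s))

end Algorithm

end ForcedTSP

/-! The proof rests on an invariant and a measure. Each configuration has a value (`Config.Value`):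
the optimum for a pending valid problem, the minimum of the two values for a fork, the result itself
for a returned result. `Step.value` shows that steps preserve it, and `Config.Value.exists_step`
that only a returned result is stuck; so an execution that stops has returned the optimum of its
input. Executions are finite because `Problem.size` drops from each problem to the problems created
from it.

Hamiltonian cycles are handled as `IsHam`: connected edge sets with all degrees 2. This is
equivalent to the cyclic listing: by parity, every edge of a set with even degrees lies on a cycle,
and a connected 2-regular set contains no cycle but itself. Degrees and connectivity behave well
when vertices are identified, so both contractions reduce to facts about quotients: a tour is lifted
by restoring `e₂`, or two edges of the triangle.

If none of (a)-(h) applies, the graph is cubic and loopless, with at most one forced edge at each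
vertex. In a cubic graph a tour omits exactly one triangle edge, together with the outer edge at the
opposite corner; the outer edges at the other two corners pay for the triangle edges opposite to
them. Hence the Delta-Y step is sound.

If the unforced edges form disjoint 4-cycles, every vertex has one forced edge and two edges of its
4-cycle. A tour therefore uses one of the two opposite pairs on each 4-cycle, and is given by the
set of switched cycles. Every such choice is 2-regular; only connectivity is at stake. In a
2-regular set the ends of an edge remain connected without it, so switching a 4-cycle that meets two
components merges them. Thus switching a spanning tree of the patch graph gives a tour. Conversely,
the switched cycles of a tour contain a spanning tree, and the others have nonnegative cost, so a
minimum spanning tree is optimal. -/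

namespace ForcedTSP

open Classical Relation

/-! ### Degrees, connectivity and cycles in multigraphs. -/

section Connectivity

variable {α β : Type*} {G : Graph α β}

/-- The number of ends of the edge `f` at the vertex `x`. -/
noncomputable def endCount (G : Graph α β) (f : β) (x : α) : ℕ :=
  (if G.Inc f x then 1 else 0) + (if G.IsLoopAt f x then 1 else 0)

/-- The degree of `x` with respect to the edges in `C`. -/
noncomputable def degIn (G : Graph α β) (C : Finset β) (x : α) : ℕ := ∑ f ∈ C, endCount G f x

/-- The vertices `x` and `y` are connected by edges in `C`. -/
def Conn (G : Graph α β) (C : Set β) : α → α → Prop :=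
  ReflTransGen fun u v => ∃ f ∈ C, G.IsLink f u v

lemma endCount_of_isLink {f : β} {u v : α} (h : G.IsLink f u v) (x : α) :
    endCount G f x = (if u = x then 1 else 0) + (if v = x then 1 else 0) := by
  have h1 : G.Inc f x ↔ u = x ∨ v = x := by
    constructor
    · intro hx
      rcases hx.eq_or_eq_of_isLink h with rfl | rfl <;> simp
    · rintro (rfl | rfl)
      exacts [h.inc_left, h.inc_right]
  have h2 : G.IsLoopAt f x ↔ u = x ∧ v = x := by
    rw [← Graph.isLink_self_iff, h.isLink_iff]
    tauto
  simp only [endCount, h1, h2]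
  by_cases hu : u = x <;> by_cases hv : v = x <;> simp [hu, hv]

lemma endCount_eq_zero {f : β} {x : α} (h : ¬ G.Inc f x) : endCount G f x = 0 := by
  have h' : ¬ G.IsLoopAt f x := fun hl => h hl.inc
  simp [endCount, h, h']

lemma one_le_endCount {f : β} {x : α} (h : G.Inc f x) : 1 ≤ endCount G f x := by
  simp [endCount, h]

lemma endCount_eq_one {f : β} {x y : α} (h : G.IsLink f x y) (hy : y ≠ x) :
    endCount G f x = 1 := by
  simp [endCount_of_isLink h, hy]

lemma endCount_eq_two {f : β} {x : α} (h : G.IsLoopAt f x) : endCount G f x = 2 := by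
  simp [endCount, h, h.inc]

lemma degree_eq_degIn {E : Finset β} (hE : (E : Set β) = E(G)) (x : α) :
    degree G x = degIn G E x := by
  have h1 : G.incidenceSet x = ↑(E.filter fun f => G.Inc f x) := by
    ext f
    have : G.Inc f x → f ∈ E := fun h => by rw [← Finset.mem_coe, hE]; exact h.edge_mem
    simp; tauto
  have h2 : G.loopSet x = ↑(E.filter fun f => G.IsLoopAt f x) := by
    ext f
    have : G.IsLoopAt f x → f ∈ E := fun h => by rw [← Finset.mem_coe, hE]; exact h.edge_mem
    simp; tauto
  rw [degree, h1, h2, Set.ncard_coe_finset, Set.ncard_coe_finset, degIn]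
  simp [endCount, Finset.sum_add_distrib]

lemma degIn_mono {C D : Finset β} (h : C ⊆ D) (x : α) : degIn G C x ≤ degIn G D x :=
  Finset.sum_le_sum_of_subset h

lemma degIn_insert {C : Finset β} {f : β} (hf : f ∉ C) (x : α) :
    degIn G (insert f C) x = endCount G f x + degIn G C x :=
  Finset.sum_insert hf

lemma degIn_erase_add {C : Finset β} {f : β} (hf : f ∈ C) (x : α) :
    degIn G (C.erase f) x + endCount G f x = degIn G C x :=
  Finset.sum_erase_add _ _ hf

lemma degIn_sdiff_add {C D : Finset β} (h : D ⊆ C) (x : α) :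
    degIn G (C \ D) x + degIn G D x = degIn G C x :=
  Finset.sum_sdiff h

lemma degIn_union {C D : Finset β} (h : Disjoint C D) (x : α) :
    degIn G (C ∪ D) x = degIn G C x + degIn G D x :=
  Finset.sum_union h

lemma degIn_filter_inc (C : Finset β) (x : α) :
    degIn G (C.filter fun f => G.Inc f x) x = degIn G C x := by
  refine Finset.sum_filter_of_ne fun f _ h => ?_
  by_contra hf
  exact h (endCount_eq_zero hf)

lemma card_inc_le_degIn (C : Finset β) (x : α) :
    (C.filter fun f => G.Inc f x).card ≤ degIn G C x := by
  rw [← degIn_filter_inc, Finset.card_eq_sum_ones]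
  exact Finset.sum_le_sum fun f hf => one_le_endCount (Finset.mem_filter.1 hf).2

/-- If a subset of `C` has the full degree at `x`, then it contains all edges of `C` at `x`. -/
lemma mem_of_degIn_le {C D : Finset β} (hDC : D ⊆ C) {x : α} (h : degIn G C x ≤ degIn G D x)
    {f : β} (hf : f ∈ C) (hx : G.Inc f x) : f ∈ D := by
  by_contra hfD
  have h1 := degIn_mono (G := G) (Finset.insert_subset hf hDC) x
  rw [degIn_insert hfD] at h1
  have := one_le_endCount hx
  omega

lemma Conn.symm {C : Set β} {x y : α} (h : Conn G C x y) : Conn G C y x := by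
  induction h with
  | refl => exact .refl
  | tail _ h ih =>
    obtain ⟨f, hf, hl⟩ := h
    exact ReflTransGen.head ⟨f, hf, hl.symm⟩ ih

lemma Conn.trans {C : Set β} {x y z : α} (h : Conn G C x y) (h' : Conn G C y z) : Conn G C x z :=
  ReflTransGen.trans h h'

lemma Conn.mono {C D : Set β} (hCD : C ⊆ D) {x y : α} (h : Conn G C x y) : Conn G D x y := by
  induction h with
  | refl => exact .refl
  | tail _ h ih =>
    obtain ⟨f, hf, hl⟩ := h
    exact ReflTransGen.tail ih ⟨f, hCD hf, hl⟩

lemma Conn.of_isLink {C : Set β} {f : β} {x y : α} (hf : f ∈ C) (h : G.IsLink f x y) :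
    Conn G C x y :=
  ReflTransGen.single ⟨f, hf, h⟩

/-- Connectivity is transferred along a map under which the edges of `C` join connected vertices. -/
lemma Conn.map {α' β' : Type*} {G' : Graph α' β'} {C : Set β} {C' : Set β'} {φ : α → α'}
    (h : ∀ f ∈ C, ∀ u v, G.IsLink f u v → Conn G' C' (φ u) (φ v)) {x y : α}
    (hxy : Conn G C x y) : Conn G' C' (φ x) (φ y) := by
  induction hxy with
  | refl => exact .refl
  | tail _ hl ih =>
    obtain ⟨f, hf, hl⟩ := hl
    exact ih.trans (h f hf _ _ hl)

lemma mem_component_iff {C : Set β} {x y : α} :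
    y ∈ component (G.restrict C) x ↔ Conn G C x y := by
  have : (G.restrict C).Adj = fun u v => ∃ f ∈ C, G.IsLink f u v := by
    ext u v
    simp [Graph.Adj]
  simp [component, Conn, this]

lemma sum_endCount {f : β} {u v : α} (h : G.IsLink f u v) (K : Finset α) :
    ∑ x ∈ K, endCount G f x = (if u ∈ K then 1 else 0) + (if v ∈ K then 1 else 0) := by
  simp [endCount_of_isLink h, Finset.sum_add_distrib]

/-- The handshake lemma for a set of vertices that is not left by the edges of `C`. -/
lemma even_sum_degIn {C : Finset β} (hC : (C : Set β) ⊆ E(G)) {K : Finset α}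
    (hK : ∀ f ∈ C, ∀ u v, G.IsLink f u v → u ∈ K → v ∈ K) : Even (∑ x ∈ K, degIn G C x) := by
  unfold degIn
  rw [Finset.sum_comm]
  refine Finset.even_sum _ fun f hf => ?_
  obtain ⟨u, v, h⟩ := Graph.exists_isLink_of_mem_edgeSet (hC hf)
  rw [sum_endCount h]
  have h1 := hK f hf u v h
  have h2 := hK f hf v u h.symm
  by_cases hu : u ∈ K <;> by_cases hv : v ∈ K <;> simp_all

/-- If all degrees are even, then the removal of an edge does not disconnect its ends. -/
lemma conn_erase_of_even {C : Finset β} (hC : (C : Set β) ⊆ E(G)) (hV : V(G).Finite)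
    (hdeg : ∀ x ∈ V(G), Even (degIn G C x)) {i : β} (hi : i ∈ C) {x y : α}
    (h : G.IsLink i x y) : Conn G (↑(C.erase i)) x y := by
  by_contra hxy
  -- `K` is the component of `x` without `i`. If it missed `y`, exactly one end of `i` would lie in
  -- `K`, so the degree sums over `K` with and without `i` would differ by one; yet both are even.
  set K : Finset α := hV.toFinset.filter fun v => Conn G (↑(C.erase i)) x v with hKdef
  have hxK : x ∈ K := by simp [hKdef, h.left_mem]; exact .refl
  have hyK : y ∉ K := by simp only [hKdef, Finset.mem_filter]; tauto
  have h1 : Even (∑ v ∈ K, degIn G (C.erase i) v) := by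
    refine even_sum_degIn (fun f hf => hC (Finset.erase_subset _ _ hf)) ?_
    intro f hf u v hl hu
    simp only [hKdef, Finset.mem_filter, Set.Finite.mem_toFinset] at hu ⊢
    exact ⟨hl.right_mem, hu.2.trans (.of_isLink hf hl)⟩
  have h2 : Even (∑ v ∈ K, degIn G C v) :=
    Finset.even_sum _ fun v hv => hdeg v (by simpa using (Finset.mem_filter.1 hv).1)
  have h3 : ∑ v ∈ K, degIn G C v = ∑ v ∈ K, degIn G (C.erase i) v + 1 := by
    rw [← show ∑ v ∈ K, endCount G i v = 1 by simp [sum_endCount h, hxK, hyK],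
      ← Finset.sum_add_distrib]
    exact Finset.sum_congr rfl fun v _ => (degIn_erase_add hi v).symm
  rw [h3] at h2
  exact (Nat.even_add_one.1 h2) h1

/-- A walk of least length repeats no vertex, for the part between two visits could be cut out. -/
lemma exists_path_of_reflTransGen {r : α → α → Prop} {x y : α} (h : ReflTransGen r x y) :
    ∃ (n : ℕ) (p : ℕ → α), p 0 = x ∧ p n = y ∧ (∀ j < n, r (p j) (p (j + 1))) ∧
      ∀ i j, i < j → j ≤ n → p i ≠ p j := by
  have hex : ∃ (n : ℕ) (p : ℕ → α), p 0 = x ∧ p n = y ∧ ∀ j < n, r (p j) (p (j + 1)) := by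
    induction h with
    | refl => exact ⟨0, fun _ => x, rfl, rfl, by simp⟩
    | @tail b c _ hbc ih =>
      obtain ⟨n, p, h0, hn, hp⟩ := ih
      refine ⟨n + 1, fun j => if j ≤ n then p j else c, by simpa using h0, by simp, ?_⟩
      intro j hj
      rcases Nat.lt_or_ge j n with h | h
      · simpa [h.le, Nat.succ_le_of_lt h] using hp j h
      · obtain rfl : j = n := by omega
        simpa [hn] using hbc
  obtain ⟨p, h0, hn, hp⟩ := Nat.find_spec hex
  refine ⟨Nat.find hex, p, h0, hn, hp, fun i j hij hjn heq => ?_⟩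
  -- If `p i = p j`, the walk that jumps from index `i` to index `j` is shorter by `j - i`.
  refine Nat.find_min hex (m := Nat.find hex - (j - i)) (by omega)
    ⟨fun l => if l ≤ i then p l else p (l + (j - i)), by simpa using h0, ?_, ?_⟩
  · by_cases hl : Nat.find hex - (j - i) ≤ i
    · have : j = Nat.find hex := by omega
      have h' : Nat.find hex - (j - i) = i := by omega
      simp only [h', le_refl, if_true, heq]
      rw [this, hn]
    · simp only [hl, if_false]
      rw [Nat.sub_add_cancel (by omega), hn]
  · intro l hl
    rcases lt_trichotomy l i with h | h | h
    · simpa [h.le, Nat.succ_le_of_lt h] using hp l (by omega)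
    · subst h
      have := hp j (by omega)
      simp only [le_refl, if_true, show ¬ l + 1 ≤ l by omega, if_false, heq]
      rwa [show l + 1 + (j - l) = j + 1 by omega]
    · have := hp (l + (j - i)) (by omega)
      simp only [show ¬ l ≤ i by omega, show ¬ l + 1 ≤ i by omega, if_false]
      rwa [show l + 1 + (j - i) = l + (j - i) + 1 by omega]

/-- An edge whose ends are connected by other edges lies on a cycle. -/
lemma exists_isCycle {S : Set β} {i : β} (hi : i ∉ S) {x y : α} (h : G.IsLink i x y)
    (hxy : Conn G S x y) : ∃ (n : ℕ) (w : Fin (n + 1) → α) (e : Fin (n + 1) → β),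
      IsCycle G w e ∧ Set.range e ⊆ insert i S := by
  obtain ⟨n, p, h0, hn, hp, hinj⟩ := exists_path_of_reflTransGen hxy
  have : Nonempty β := ⟨i⟩
  choose! q hqS hq using hp
  have hpinj : ∀ i j, i ≤ n → j ≤ n → p i = p j → i = j := by
    intro i j hi hj hij
    rcases lt_trichotomy i j with h | h | h
    · exact absurd hij (hinj i j h hj)
    · exact h
    · exact absurd hij.symm (hinj j i h hi)
  refine ⟨n, fun j => p j, fun j => if (j : ℕ) < n then q j else i, ⟨?_, ?_, ?_⟩, ?_⟩
  · intro a b hab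
    exact Fin.ext (hpinj a b (by omega) (by omega) hab)
  · intro a b hab
    have hne : ∀ j < n, q j ≠ i := fun j hj hji => hi (hji ▸ hqS j hj)
    by_cases ha : (a : ℕ) < n <;> by_cases hb : (b : ℕ) < n
    · simp only [ha, hb, if_true] at hab
      have h1 := hq a ha
      rw [hab] at h1
      -- Equal edges have the same ends. In reversed order this would give both `a = b + 1` and `b =
      -- a + 1`.
      rcases (hq b hb).eq_and_eq_or_eq_and_eq h1 with h | h
      · exact Fin.ext (hpinj _ _ (by omega) (by omega) h.1.symm)
      · have h2 := hpinj _ _ (by omega) (by omega) h.1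
        have h3 := hpinj _ _ (by omega) (by omega) h.2
        omega
    · simp only [ha, hb, if_true, if_false] at hab
      exact absurd hab (hne a ha)
    · simp only [ha, hb, if_true, if_false] at hab
      exact absurd hab.symm (hne b hb)
    · exact Fin.ext (by omega)
  · intro j
    by_cases hj : (j : ℕ) < n
    · simp only [hj, if_true]
      have : ((j + 1 : Fin (n + 1)) : ℕ) = j + 1 := Fin.val_add_one_of_lt' (by omega)
      rw [this]
      exact hq j hj
    · obtain rfl : j = Fin.last n := Fin.ext (by simp; omega)
      simpa [h0, hn] using h.symm
  · rintro _ ⟨j, rfl⟩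
    by_cases hj : (j : ℕ) < n
    · simp only [hj, if_true]
      exact Or.inr (hqS j hj)
    · simp [hj]

/-- The vertices of a cycle are connected by the edges other than the last one. -/
lemma IsCycle.conn_last {n : ℕ} {w : Fin (n + 1) → α} {e : Fin (n + 1) → β} (h : IsCycle G w e)
    (i : Fin (n + 1)) : Conn G (Set.range e \ {e (Fin.last n)}) (w 0) (w i) := by
  induction i using Fin.induction with
  | zero => exact .refl
  | succ i ih =>
    refine ih.trans (.of_isLink (f := e i.castSucc) ⟨⟨_, rfl⟩, ?_⟩ ?_)
    · intro hi
      exact (Fin.castSucc_lt_last i).ne (h.2.1 hi)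
    · have := h.2.2 i.castSucc
      rwa [Fin.coeSucc_eq_succ] at this

lemma IsCycle.conn {k : ℕ} [NeZero k] {w : Fin k → α} {e : Fin k → β} (h : IsCycle G w e)
    (i j : Fin k) : Conn G (Set.range e) (w i) (w j) := by
  obtain ⟨n, rfl⟩ := Nat.exists_eq_succ_of_ne_zero (NeZero.ne k)
  have : ∀ i, Conn G (Set.range e) (w 0) (w i) := fun i => (h.conn_last i).mono Set.sdiff_subset
  exact (this i).symm.trans (this j)

lemma IsCycle.degIn {k : ℕ} [NeZero k] {w : Fin k → α} {e : Fin k → β} (h : IsCycle G w e)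
    (i : Fin k) : degIn G (Finset.univ.image e) (w i) = 2 := by
  rw [ForcedTSP.degIn, Finset.sum_image (fun a _ b _ hab => h.2.1 hab)]
  simp only [endCount_of_isLink (h.2.2 _), Finset.sum_add_distrib, h.1.eq_iff]
  have : ∀ j : Fin k, (j + 1 = i) = (j = i - 1) := fun j => by rw [eq_sub_iff_add_eq]
  simp [this]

/-- A Hamiltonian cycle, described by degrees and connectivity. -/
structure IsHam (G : Graph α β) (C : Finset β) : Prop where
  nonempty : V(G).Nonempty
  subset : (C : Set β) ⊆ E(G)
  degIn : ∀ x ∈ V(G), degIn G C x = 2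
  conn : ∀ x ∈ V(G), ∀ y ∈ V(G), Conn G C x y

/-- A Hamiltonian cycle contains no other cycle. -/
lemma IsHam.eq_of_isCycle {C : Finset β} (hC : IsHam G C) {k : ℕ} [NeZero k] {w : Fin k → α}
    {e : Fin k → β} (h : IsCycle G w e) (he : Set.range e ⊆ C) :
    Set.range w = V(G) ∧ Set.range e = C := by
  have hw : ∀ i, w i ∈ V(G) := fun i => (h.2.2 i).left_mem
  -- The cycle already uses up the degree 2 of `C` at each of its vertices, so no other edge of `C`
  -- meets it; connectivity then leaves no vertex outside.
  have hmem : ∀ f ∈ C, ∀ i, G.Inc f (w i) → f ∈ Set.range e := by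
    intro f hf i hi
    have := mem_of_degIn_le (G := G) (C := C) (D := Finset.univ.image e)
      (by intro f hf; simp at hf; exact he hf) (x := w i)
      (by rw [h.degIn, hC.degIn _ (hw i)]) hf hi
    simpa using this
  have hclosed : ∀ v, Conn G C (w 0) v → v ∈ Set.range w := by
    intro v hv
    induction hv with
    | refl => exact ⟨0, rfl⟩
    | tail _ hl ih =>
      obtain ⟨f, hf, hl⟩ := hl
      obtain ⟨i, rfl⟩ := ih
      obtain ⟨j, rfl⟩ := hmem f hf i hl.inc_left
      rcases hl.right_eq_or_eq (h.2.2 j) with h | h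
      exacts [⟨_, h.symm⟩, ⟨_, h.symm⟩]
  have hV : Set.range w = V(G) :=
    Set.Subset.antisymm (by rintro _ ⟨i, rfl⟩; exact hw i)
      fun v hv => hclosed v (hC.conn _ (hw 0) _ hv)
  refine ⟨hV, Set.Subset.antisymm he fun f hf => ?_⟩
  obtain ⟨u, v, hl⟩ := Graph.exists_isLink_of_mem_edgeSet (hC.subset hf)
  obtain ⟨i, rfl⟩ := hV ▸ hl.left_mem
  exact hmem f hf i hl.inc_left

/-- Since the degrees are even, any edge of `C` lies on a cycle inside `C`, and by
`IsHam.eq_of_isCycle` that cycle is all of `C`. -/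
lemma IsHam.isHamiltonianCycle {C : Finset β} (hC : IsHam G C) (hV : V(G).Finite) :
    IsHamiltonianCycle G C := by
  obtain ⟨x, hx⟩ := hC.nonempty
  have hne : ∃ f ∈ C, G.Inc f x := by
    by_contra! hno
    have : ForcedTSP.degIn G C x = 0 := Finset.sum_eq_zero fun f hf => endCount_eq_zero (hno f hf)
    have := hC.degIn x hx
    omega
  obtain ⟨i, hi, y, hl⟩ := hne
  obtain ⟨n, w, e, hcyc, hsub⟩ := exists_isCycle (by simp) hl
    (conn_erase_of_even hC.subset hV (fun v hv => by simp [hC.degIn v hv]) hi hl)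
  obtain ⟨h1, h2⟩ := hC.eq_of_isCycle hcyc (hsub.trans (by
    rw [← Finset.coe_insert, Finset.insert_erase hi]))
  exact ⟨n + 1, inferInstance, w, e, hcyc, h1, h2⟩

lemma IsHamiltonianCycle.isHam {C : Set β} (h : IsHamiltonianCycle G C) :
    ∃ D : Finset β, (D : Set β) = C ∧ IsHam G D := by
  obtain ⟨k, _, w, e, hcyc, hw, rfl⟩ := h
  have hr : ((Finset.univ.image e : Finset β) : Set β) = Set.range e := by simp
  refine ⟨Finset.univ.image e, hr, ⟨w 0, hw ▸ ⟨0, rfl⟩⟩, ?_, ?_, ?_⟩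
  · rw [hr]
    rintro _ ⟨i, rfl⟩
    exact (hcyc.2.2 i).edge_mem
  · rw [← hw]
    rintro _ ⟨i, rfl⟩
    exact hcyc.degIn i
  · rw [← hw, hr]
    rintro _ ⟨i, rfl⟩ _ ⟨j, rfl⟩
    exact hcyc.conn i j

/-- Needed for step (c): once the forced edges form a Hamiltonian cycle, they are the only tour. -/
lemma IsHam.eq_of_subset {C D : Finset β} (hV : V(G).Finite) (hC : IsHam G C) (hD : IsHam G D)
    (h : D ⊆ C) : D = C := by
  obtain ⟨k, _, w, e, hcyc, hw, he⟩ := hD.isHamiltonianCycle hV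
  have := (hC.eq_of_isCycle hcyc (by rw [he]; exact_mod_cast h)).2
  rw [he] at this
  exact_mod_cast this

end Connectivity

/-! ### Tours, optima, and the steps that only force or delete edges. -/

section Tours

variable {α β : Type*} {G : Graph α β} {P P' : Problem α β}

/-- The assumptions on the input of the algorithm, which are preserved by all of its steps. -/
structure Problem.Valid (P : Problem α β) : Prop where
  finite_vertexSet : V(P.graph).Finite
  nonempty : V(P.graph).Nonempty
  finite_edgeSet : E(P.graph).Finite
  degree_le : ∀ x ∈ V(P.graph), degree P.graph x ≤ 3
  forced_subset : P.forced ⊆ E(P.graph)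

/-- A tour as a finite set of edges. -/
def Problem.Tour (P : Problem α β) (C : Finset β) : Prop := IsHam P.graph C ∧ P.forced ⊆ C

lemma totalCost_coe (c : β → ℝ) (C : Finset β) : totalCost c (C : Set β) = ∑ f ∈ C, c f :=
  finsum_mem_coe_finset c C

lemma Problem.isTour_coe_iff (hV : V(P.graph).Finite) {C : Finset β} :
    P.IsTour (C : Set β) ↔ P.Tour C := by
  refine and_congr_left fun _ => ⟨fun h => ?_, fun h => h.isHamiltonianCycle hV⟩
  obtain ⟨D, hD, h⟩ := h.isHam
  rwa [← Finset.coe_injective hD]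

lemma Problem.IsTour.exists_tour (hV : V(P.graph).Finite) {C : Set β} (h : P.IsTour C) :
    ∃ D : Finset β, (D : Set β) = C ∧ P.Tour D := by
  obtain ⟨D, rfl, _⟩ := h.1.isHam
  exact ⟨D, rfl, (isTour_coe_iff hV).1 h⟩

lemma Problem.isOptimum_none_iff (hV : V(P.graph).Finite) :
    P.IsOptimum none ↔ ∀ C, ¬ P.Tour C := by
  refine ⟨fun h C hC => h C ((isTour_coe_iff hV).2 hC), fun h C hC => ?_⟩
  obtain ⟨D, _, hD⟩ := hC.exists_tour hV
  exact h D hD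

lemma Problem.isOptimum_some_iff (hV : V(P.graph).Finite) {t : ℝ} :
    P.IsOptimum (some t) ↔ (∃ C, P.Tour C ∧ ∑ f ∈ C, P.cost f = t) ∧
      ∀ C, P.Tour C → t ≤ ∑ f ∈ C, P.cost f := by
  refine and_congr ⟨?_, ?_⟩ ⟨?_, ?_⟩
  · rintro ⟨C, hC, rfl⟩
    obtain ⟨D, rfl, hD⟩ := hC.exists_tour hV
    exact ⟨D, hD, (totalCost_coe _ _).symm⟩
  · rintro ⟨C, hC, rfl⟩
    exact ⟨C, (isTour_coe_iff hV).2 hC, (totalCost_coe _ _).symm⟩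
  · intro h C hC
    exact h ⟨C, (isTour_coe_iff hV).2 hC, (totalCost_coe _ _).symm⟩
  · rintro h _ ⟨C, hC, rfl⟩
    obtain ⟨D, rfl, hD⟩ := hC.exists_tour hV
    rw [totalCost_coe]
    exact h D hD

/-- Two problems have the same optimum if every tour of one of them is matched by a tour of the
other one that is not more expensive. -/
lemma Problem.IsOptimum.transfer (hV : V(P.graph).Finite) (hV' : V(P'.graph).Finite)
    (h : ∀ C, P.Tour C → ∃ C', P'.Tour C' ∧ ∑ f ∈ C', P'.cost f ≤ ∑ f ∈ C, P.cost f)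
    (h' : ∀ C', P'.Tour C' → ∃ C, P.Tour C ∧ ∑ f ∈ C, P.cost f ≤ ∑ f ∈ C', P'.cost f)
    {r : Option ℝ} (hr : P.IsOptimum r) : P'.IsOptimum r := by
  cases r with
  | none =>
    rw [isOptimum_none_iff hV] at hr
    rw [isOptimum_none_iff hV']
    intro C' hC'
    obtain ⟨C, hC, _⟩ := h' C' hC'
    exact hr C hC
  | some t =>
    rw [isOptimum_some_iff hV] at hr
    rw [isOptimum_some_iff hV']
    obtain ⟨⟨C, hC, rfl⟩, hmin⟩ := hr
    have hmin' : ∀ C', P'.Tour C' → ∑ f ∈ C, P.cost f ≤ ∑ f ∈ C', P'.cost f := by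
      intro C' hC'
      obtain ⟨D, hD, hle⟩ := h' C' hC'
      exact (hmin D hD).trans hle
    obtain ⟨C', hC', hle⟩ := h C hC
    exact ⟨⟨C', hC', le_antisymm hle (hmin' C' hC')⟩, hmin'⟩

/-- There are finitely many tours because there are finitely many edges. Existence and uniqueness of
the optimum make it usable as an invariant. -/
lemma Problem.Valid.exists_isOptimum (hP : P.Valid) : ∃ r, P.IsOptimum r := by
  by_cases h : ∃ C, P.Tour C
  · have hfin : {C | P.Tour C}.Finite := by
      refine (Finset.finite_toSet hP.finite_edgeSet.toFinset.powerset).subset fun C hC => ?_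
      simpa [← Finset.coe_subset] using hC.1.subset
    obtain ⟨C, hC, hmin⟩ := Set.exists_min_image _ (fun C => ∑ f ∈ C, P.cost f) hfin h
    exact ⟨_, (isOptimum_some_iff hP.finite_vertexSet).2 ⟨⟨C, hC, rfl⟩, hmin⟩⟩
  · push Not at h
    exact ⟨none, (isOptimum_none_iff hP.finite_vertexSet).2 h⟩

lemma Problem.Valid.isOptimum_unique (hP : P.Valid) {r s : Option ℝ} (hr : P.IsOptimum r)
    (hs : P.IsOptimum s) : r = s := by
  have hV := hP.finite_vertexSet
  rcases r with _ | r <;> rcases s with _ | s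
  · rfl
  · obtain ⟨⟨C, hC, _⟩, _⟩ := (isOptimum_some_iff hV).1 hs
    exact absurd hC ((isOptimum_none_iff hV).1 hr C)
  · obtain ⟨⟨C, hC, _⟩, _⟩ := (isOptimum_some_iff hV).1 hr
    exact absurd hC ((isOptimum_none_iff hV).1 hs C)
  · exact congrArg some (IsLeast.unique hr hs)

/-- The edges of a valid problem as a finite set. -/
noncomputable def Problem.Valid.edges (hP : P.Valid) : Finset β := hP.finite_edgeSet.toFinset

lemma Problem.Valid.coe_edges (hP : P.Valid) : (hP.edges : Set β) = E(P.graph) := by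
  simp [edges]

lemma Problem.Valid.mem_edges (hP : P.Valid) {f : β} : f ∈ hP.edges ↔ f ∈ E(P.graph) := by
  simp [edges]

lemma Problem.Valid.degree_eq (hP : P.Valid) (x : α) :
    degree P.graph x = degIn P.graph hP.edges x :=
  degree_eq_degIn hP.coe_edges x

lemma Problem.Valid.degIn_le (hP : P.Valid) {x : α} (hx : x ∈ V(P.graph)) :
    degIn P.graph hP.edges x ≤ 3 :=
  hP.degree_eq x ▸ hP.degree_le x hx

lemma Problem.Valid.subset_edges (hP : P.Valid) {C : Finset β} (h : (C : Set β) ⊆ E(P.graph)) :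
    C ⊆ hP.edges := by
  rw [← Finset.coe_subset, hP.coe_edges]
  exact h

lemma Problem.Valid.force (hP : P.Valid) {A : Set β} (hA : A ⊆ E(P.graph)) :
    (P.force A).Valid :=
  { hP with forced_subset := Set.union_subset hP.forced_subset hA }

lemma Problem.tour_force_iff {A : Set β} {C : Finset β} :
    (P.force A).Tour C ↔ P.Tour C ∧ A ⊆ C := by
  simp [Tour, force, and_assoc]

/-- Common core of steps (b) and (j): forcing edges that every tour contains leaves the set of tours
unchanged. -/
lemma Problem.IsOptimum.force (hP : P.Valid) {A : Set β}
    (h : ∀ C, P.Tour C → A ⊆ C) {r : Option ℝ} (hr : P.IsOptimum r) :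
    (P.force A).IsOptimum r :=
  hr.transfer (P' := P.force A) hP.finite_vertexSet hP.finite_vertexSet
    (fun C hC => ⟨C, tour_force_iff.2 ⟨hC, h C hC⟩, le_rfl⟩)
    (fun C hC => ⟨C, (tour_force_iff.1 hC).1, le_rfl⟩)

lemma endCount_deleteEdges {D : Set β} {f : β} (hf : f ∉ D) (x : α) :
    endCount (G.deleteEdges D) f x = endCount G f x := by
  simp [endCount, hf]

lemma degIn_deleteEdges {D : Set β} {C : Finset β} (h : ∀ f ∈ C, f ∉ D) (x : α) :
    degIn (G.deleteEdges D) C x = degIn G C x :=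
  Finset.sum_congr rfl fun f hf => endCount_deleteEdges (h f hf) x

lemma isHam_deleteEdges_iff {D : Set β} {C : Finset β} :
    IsHam (G.deleteEdges D) C ↔ IsHam G C ∧ ∀ f ∈ C, f ∉ D := by
  have hconn : ∀ (_ : ∀ f ∈ C, f ∉ D) (x y : α),
      Conn (G.deleteEdges D) C x y ↔ Conn G C x y := by
    intro hd x y
    constructor
    · refine Conn.map (φ := id) fun f hf u v hl => .of_isLink hf ?_
      simpa [hd f hf] using hl
    · refine Conn.map (φ := id) fun f hf u v hl => .of_isLink hf ?_
      simpa [hd f hf] using hl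
  constructor
  · intro h
    have hd : ∀ f ∈ C, f ∉ D := fun f hf => (by simpa using h.subset hf : _ ∧ _).2
    refine ⟨⟨h.nonempty, fun f hf => (by simpa using h.subset hf : _ ∧ _).1, ?_, ?_⟩, hd⟩
    · intro x hx
      rw [← degIn_deleteEdges hd]
      exact h.degIn x hx
    · intro x hx y hy
      exact (hconn hd x y).1 (h.conn x hx y hy)
  · rintro ⟨h, hd⟩
    refine ⟨h.nonempty, fun f hf => by simpa using ⟨h.subset hf, hd f hf⟩, ?_, ?_⟩
    · intro x hx
      rw [degIn_deleteEdges hd]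
      exact h.degIn x hx
    · intro x hx y hy
      exact (hconn hd x y).2 (h.conn x hx y hy)

lemma Problem.tour_delete_iff {f : β} {C : Finset β} :
    (P.delete f).Tour C ↔ P.Tour C ∧ f ∉ C := by
  simp only [Tour, delete, isHam_deleteEdges_iff, Set.mem_singleton_iff]
  constructor
  · rintro ⟨⟨h1, h2⟩, h3⟩
    exact ⟨⟨h1, h3⟩, fun hf => h2 f hf rfl⟩
  · rintro ⟨⟨h1, h2⟩, h3⟩
    exact ⟨⟨h1, fun g hg hgf => h3 (hgf ▸ hg)⟩, h2⟩

lemma Problem.Valid.delete (hP : P.Valid) {f : β} (hf : f ∉ P.forced) : (P.delete f).Valid where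
  finite_vertexSet := hP.finite_vertexSet
  nonempty := hP.nonempty
  finite_edgeSet := hP.finite_edgeSet.subset (by simp [Problem.delete])
  degree_le x hx := by
    have hE : ((hP.edges.erase f : Finset β) : Set β) = E((P.delete f).graph) := by
      simp [Problem.delete, hP.coe_edges]
    rw [degree_eq_degIn hE]
    refine (degIn_deleteEdges ?_ x).trans_le
      ((degIn_mono (Finset.erase_subset _ _) x).trans (hP.degIn_le hx))
    intro g hg
    simpa using Finset.ne_of_mem_erase hg
  forced_subset g hg := by
    simp only [Problem.delete, Graph.edgeSet_deleteEdges]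
    exact ⟨hP.forced_subset hg, fun h => hf (h ▸ hg)⟩

/-- A Hamiltonian cycle in a graph with more than one vertex contains no loop. -/
lemma IsHam.not_isLoopAt {C : Finset β} (hC : IsHam G C) (hV : 1 < V(G).ncard) {f : β}
    (hf : f ∈ C) (x : α) : ¬ G.IsLoopAt f x := by
  intro hl
  have := (hC.eq_of_isCycle (k := 1) (w := fun _ => x) (e := fun _ => f)
    ⟨Function.injective_of_subsingleton _, Function.injective_of_subsingleton _, fun _ => hl⟩
    (by rintro _ ⟨_, rfl⟩; exact hf)).1
  rw [← this, Set.range_const, Set.ncard_singleton] at hV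
  omega

/-- A Hamiltonian cycle in a graph with more than two vertices contains no parallel edges. -/
lemma IsHam.not_parallel {C : Finset β} (hC : IsHam G C) (hV : 2 < V(G).ncard) {f g : β}
    {x y : α} (hfg : f ≠ g) (hf : f ∈ C) (hg : g ∈ C) (hlf : G.IsLink f x y) :
    ¬ G.IsLink g x y := by
  intro hlg
  have hxy : x ≠ y := by
    rintro rfl
    exact hC.not_isLoopAt (by omega) hf x hlf
  have hcyc : IsCycle G ![x, y] ![f, g] := by
    refine ⟨?_, ?_, ?_⟩
    · intro i j
      fin_cases i <;> fin_cases j <;> simp [hxy, hxy.symm]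
    · intro i j
      fin_cases i <;> fin_cases j <;> simp [hfg, hfg.symm]
    · intro i
      fin_cases i
      · simpa using hlf
      · simpa using hlg.symm
  have := (hC.eq_of_isCycle hcyc (by
    rintro _ ⟨i, rfl⟩
    fin_cases i
    exacts [hf, hg])).1
  rw [← this, show Set.range ![x, y] = {x, y} by simp [Set.pair_comm]] at hV
  have := Set.ncard_pair hxy
  omega

/-- An edge of a Hamiltonian cycle may be replaced by a parallel edge. -/
lemma IsHam.swap {C : Finset β} (hC : IsHam G C) {f g : β} {x y : α} (hf : f ∈ C) (hg : g ∉ C)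
    (hlf : G.IsLink f x y) (hlg : G.IsLink g x y) : IsHam G (insert g (C.erase f)) := by
  refine ⟨hC.nonempty, ?_, ?_, ?_⟩
  · intro h hh
    simp only [Finset.coe_insert, Finset.coe_erase, Set.mem_insert_iff] at hh
    rcases hh with rfl | hh
    exacts [hlg.edge_mem, hC.subset hh.1]
  · intro v hv
    rw [degIn_insert (by simp [hg]), ← hC.degIn v hv, ← degIn_erase_add hf, endCount_of_isLink hlg,
      endCount_of_isLink hlf]
    ring
  · intro u hu v hv
    refine Conn.map (φ := id) (fun h hh u v hl => ?_) (hC.conn u hu v hv)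
    by_cases hhf : h = f
    · subst hhf
      refine .of_isLink (f := g) (by simp) ?_
      rw [hlg.isLink_iff]
      exact hlf.isLink_iff.1 hl
    · exact .of_isLink (f := h) (by simp [hhf]; exact Or.inr hh) hl

lemma Problem.isOptimum_none_of_degree_le_one (hP : P.Valid) {x : α} (hx : x ∈ V(P.graph))
    (hd : degree P.graph x ≤ 1) : P.IsOptimum none := by
  rw [isOptimum_none_iff hP.finite_vertexSet]
  intro C hC
  have h1 := hC.1.degIn x hx
  have h2 := degIn_mono (G := P.graph) (hP.subset_edges hC.1.subset) x
  rw [hP.degree_eq] at hd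
  omega

lemma Problem.Tour.incidenceSet_subset (hP : P.Valid) {C : Finset β} (hC : P.Tour C) {x : α}
    (hx : x ∈ V(P.graph)) (hd : degree P.graph x = 2) : P.graph.incidenceSet x ⊆ C := by
  intro f hf
  refine mem_of_degIn_le (hP.subset_edges hC.1.subset) ?_ (hP.mem_edges.2 hf.edge_mem) hf
  rw [← hP.degree_eq, hd, hC.1.degIn x hx]

lemma Problem.isOptimum_forced (hP : P.Valid) (h : IsHamiltonianCycle P.graph P.forced) :
    P.IsOptimum (some (totalCost P.cost P.forced)) := by
  obtain ⟨D, hD, hham⟩ := h.isHam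
  rw [isOptimum_some_iff hP.finite_vertexSet, ← hD, totalCost_coe]
  refine ⟨⟨D, ⟨hham, hD.ge⟩, rfl⟩, fun C hC => ?_⟩
  rw [hC.1.eq_of_subset hP.finite_vertexSet hham (by
    rw [← Finset.coe_subset, hD]; exact hC.2)]

lemma Problem.isOptimum_none_of_isCycle (hP : P.Valid) {k : ℕ} [NeZero k] {w : Fin k → α}
    {e : Fin k → β} (h : IsCycle P.graph w e) (hF : Set.range e ⊆ P.forced)
    (hne : Set.range w ≠ V(P.graph)) : P.IsOptimum none := by
  rw [isOptimum_none_iff hP.finite_vertexSet]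
  intro C hC
  exact hne (hC.1.eq_of_isCycle h (hF.trans hC.2)).1

lemma Problem.isOptimum_none_of_claw (hP : P.Valid) {x : α}
    (h : 3 ≤ (P.graph.incidenceSet x ∩ P.forced).ncard) : P.IsOptimum none := by
  rw [isOptimum_none_iff hP.finite_vertexSet]
  intro C hC
  have hx : x ∈ V(P.graph) := by
    obtain ⟨f, hf, _⟩ := Set.nonempty_of_ncard_ne_zero
      (s := P.graph.incidenceSet x ∩ P.forced) (by omega)
    exact hf.vertex_mem
  have hsub : P.graph.incidenceSet x ∩ P.forced ⊆ ↑(C.filter fun f => P.graph.Inc f x) := by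
    rintro f ⟨hf, hfF⟩
    simpa using ⟨hC.2 hfF, hf⟩
  have h1 := Set.ncard_le_ncard hsub (Finset.finite_toSet _)
  rw [Set.ncard_coe_finset] at h1
  have h2 := card_inc_le_degIn (G := P.graph) C x
  have h3 := hC.1.degIn x hx
  omega

/-- With more than two vertices no tour contains both edges. So if a tour uses `f`, then `g` is not
in it, hence not forced, hence no dearer than `f`, and can take its place. -/
lemma Problem.IsOptimum.delete_parallel (hP : P.Valid) {x y : α} {f g : β} (hne : f ≠ g)
    (hf : P.graph.IsLink f x y) (hg : P.graph.IsLink g x y) (hV : 2 < V(P.graph).ncard)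
    (hfF : f ∉ P.forced) (h : g ∈ P.forced ∨ P.cost g ≤ P.cost f) {r : Option ℝ}
    (hr : P.IsOptimum r) : (P.delete f).IsOptimum r := by
  refine hr.transfer (P' := P.delete f) hP.finite_vertexSet hP.finite_vertexSet ?_
    fun C hC => ⟨C, (tour_delete_iff.1 hC).1, le_rfl⟩
  intro C hC
  by_cases hfC : f ∈ C
  · have hgC : g ∉ C := fun hgC => hC.1.not_parallel hV hne hfC hgC hf hg
    have hcost : P.cost g ≤ P.cost f := h.resolve_left fun hgF => hgC (hC.2 hgF)
    refine ⟨insert g (C.erase f), tour_delete_iff.2 ⟨⟨hC.1.swap hfC hgC hf hg, ?_⟩, by simp [hne]⟩,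
      ?_⟩
    · intro e he
      have hef : e ≠ f := fun h => hfF (h ▸ he)
      have := hC.2 he
      simp_all
    · change ∑ e ∈ insert g (C.erase f), P.cost e ≤ _
      rw [Finset.sum_insert (by simp [hgC]), ← Finset.sum_erase_add _ _ hfC]
      linarith
  · exact ⟨C, tour_delete_iff.2 ⟨hC, hfC⟩, le_rfl⟩

lemma Problem.IsOptimum.delete_loop (hP : P.Valid) {x : α} {f : β} (hf : P.graph.IsLoopAt f x)
    (hV : 1 < V(P.graph).ncard) {r : Option ℝ} (hr : P.IsOptimum r) :
    (P.delete f).IsOptimum r :=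
  hr.transfer (P' := P.delete f) hP.finite_vertexSet hP.finite_vertexSet
    (fun C hC => ⟨C, tour_delete_iff.2 ⟨hC, fun hfC => hC.1.not_isLoopAt hV hfC x hf⟩, le_rfl⟩)
    fun C hC => ⟨C, (tour_delete_iff.1 hC).1, le_rfl⟩

/-- Every tour either contains `f` or avoids it. -/
lemma Problem.IsOptimum.merge (hP : P.Valid) (f : β) {r s : Option ℝ}
    (hr : (P.force {f}).IsOptimum r) (hs : (P.delete f).IsOptimum s) :
    P.IsOptimum (Option.merge min r s) := by
  have hV := hP.finite_vertexSet
  have hcases : ∀ C, P.Tour C → (P.force {f}).Tour C ∨ (P.delete f).Tour C := by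
    intro C hC
    by_cases hf : f ∈ C
    · exact Or.inl (tour_force_iff.2 ⟨hC, by simpa using hf⟩)
    · exact Or.inr (tour_delete_iff.2 ⟨hC, hf⟩)
  have h1 : ∀ C, (P.force {f}).Tour C → P.Tour C := fun C hC => (tour_force_iff.1 hC).1
  have h2 : ∀ C, (P.delete f).Tour C → P.Tour C := fun C hC => (tour_delete_iff.1 hC).1
  have hV1 : V((P.force {f}).graph).Finite := hV
  have hV2 : V((P.delete f).graph).Finite := hV
  rcases r with _ | r <;> rcases s with _ | s
  · rw [isOptimum_none_iff hV1] at hr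
    rw [isOptimum_none_iff hV2] at hs
    exact (isOptimum_none_iff hV).2 fun C hC => (hcases C hC).elim (hr C) (hs C)
  · rw [isOptimum_none_iff hV1] at hr
    rw [isOptimum_some_iff hV2] at hs
    obtain ⟨⟨C, hC, rfl⟩, hmin⟩ := hs
    exact (isOptimum_some_iff hV).2 ⟨⟨C, h2 C hC, rfl⟩,
      fun D hD => (hcases D hD).elim (fun h => absurd h (hr D)) (hmin D)⟩
  · rw [isOptimum_some_iff hV1] at hr
    rw [isOptimum_none_iff hV2] at hs
    obtain ⟨⟨C, hC, rfl⟩, hmin⟩ := hr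
    exact (isOptimum_some_iff hV).2 ⟨⟨C, h1 C hC, rfl⟩,
      fun D hD => (hcases D hD).elim (hmin D) (fun h => absurd h (hs D))⟩
  · rw [isOptimum_some_iff hV1] at hr
    rw [isOptimum_some_iff hV2] at hs
    obtain ⟨⟨C, hC, hCr⟩, hmin⟩ := hr
    obtain ⟨⟨D, hD, hDs⟩, hmin'⟩ := hs
    refine (isOptimum_some_iff hV).2 ⟨?_, fun B hB => (hcases B hB).elim
      (fun h => (min_le_left _ _).trans (hmin B h)) (fun h => (min_le_right _ _).trans (hmin' B h))⟩
    rcases min_choice r s with h | h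
    · exact ⟨C, h1 C hC, hCr.trans h.symm⟩
    · exact ⟨D, h2 D hD, hDs.trans h.symm⟩

end Tours

/-! ### Degrees and connectivity under identification of vertices. -/

section Quotients

variable {α β : Type*} {G : Graph α β} {P : Problem α β}

/-- The graph obtained by deleting the edges in `D` and identifying vertices with the same image. -/
noncomputable abbrev quotient (G : Graph α β) (D : Set β) (φ : α → α) : Graph α β :=
  (G.deleteEdges D).map φ

lemma quotient_isLink {D : Set β} {φ : α → α} {f : β} (hf : f ∉ D) {u v : α}
    (h : G.IsLink f u v) : (quotient G D φ).IsLink f (φ u) (φ v) :=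
  Graph.IsLink.map φ (by simpa [hf] using h)

lemma exists_isLink_of_quotient {D : Set β} {φ : α → α} {f : β} {u' v' : α}
    (h : (quotient G D φ).IsLink f u' v') :
    f ∉ D ∧ ∃ u v, G.IsLink f u v ∧ φ u = u' ∧ φ v = v' := by
  obtain ⟨u, v, h, hu, hv⟩ := h
  have := h
  simp only [Graph.deleteEdges_isLink] at this
  exact ⟨by tauto, u, v, by tauto, hu, hv⟩

lemma mem_edgeSet_quotient {D : Set β} {φ : α → α} {f : β} :
    f ∈ E(quotient G D φ) ↔ f ∈ E(G) ∧ f ∉ D := by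
  simp [quotient]

/-- The degree of a vertex of a quotient is the sum of the degrees of its preimages. -/
lemma degIn_quotient (hV : V(G).Finite) {D : Set β} {φ : α → α} {C : Finset β}
    (hC : (C : Set β) ⊆ E(G)) (hCD : ∀ f ∈ C, f ∉ D) (z : α) :
    degIn (quotient G D φ) C z = ∑ x ∈ hV.toFinset.filter (fun x => φ x = z), degIn G C x := by
  unfold degIn
  rw [Finset.sum_comm]
  refine Finset.sum_congr rfl fun f hf => ?_
  obtain ⟨u, v, h⟩ := Graph.exists_isLink_of_mem_edgeSet (hC hf)
  rw [sum_endCount h, endCount_of_isLink (quotient_isLink (hCD f hf) h)]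
  simp [h.left_mem, h.right_mem]

/-- A set of edges is connected in a quotient if and only if it is connected in the graph together
with edges that connect the identified vertices. -/
lemma conn_quotient_iff {D : Set β} {φ : α → α} {C C' : Finset β} (hC' : ∀ f ∈ C', f ∉ D)
    (hsub : C' ⊆ C) (hD : ∀ f ∈ C, f ∉ C' → ∀ u v, G.IsLink f u v → φ u = φ v)
    (hφ : ∀ u ∈ V(G), ∀ v ∈ V(G), φ u = φ v → Conn G C u v) {x y : α} (hx : x ∈ V(G))
    (hy : y ∈ V(G)) : Conn (quotient G D φ) C' (φ x) (φ y) ↔ Conn G C x y := by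
  constructor
  · intro h
    -- The claim is made for all preimages of `z`: consecutive edges of a walk in the quotient lift
    -- to edges whose ends need not coincide, but are identified and hence connected in `C`.
    have key : ∀ z, Conn (quotient G D φ) C' (φ x) z → ∀ y ∈ V(G), φ y = z → Conn G C x y := by
      intro z h
      induction h with
      | refl => exact fun y hy h => hφ x hx y hy h.symm
      | tail _ hl ih =>
        intro y hy hyz
        obtain ⟨f, hf, hl⟩ := hl
        obtain ⟨_, u, v, huv, hu, hv⟩ := exists_isLink_of_quotient hl
        exact ((ih u huv.left_mem hu).trans (.of_isLink (hsub hf) huv)).trans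
          (hφ v huv.right_mem y hy (hv.trans hyz.symm))
    exact key _ h y hy rfl
  · refine Conn.map fun f hf u v hl => ?_
    by_cases hfC : f ∈ C'
    · exact .of_isLink hfC (quotient_isLink (hC' f hfC) hl)
    · rw [hD f hf hfC u v hl]
      exact .refl

end Quotients

/-! ### Contraction of two forced edges, step (f). -/

section ContractPath

variable {α β : Type*} {P : Problem α β} {x a b : α} {e₁ e₂ : β}

/-- The map that moves `x` to `b`. -/
noncomputable def moveVertex (x b : α) (y : α) : α := if y = x then b else y

lemma contractPath_graph : (P.contractPath x b e₁ e₂).graph =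
    quotient P.graph (P.graph.incidenceSet x \ {e₁}) (moveVertex x b) := rfl

lemma vertexSet_contractPath (hb : b ≠ x) (h₂ : P.graph.IsLink e₂ x b) :
    V((P.contractPath x b e₁ e₂).graph) = V(P.graph) \ {x} := by
  rw [contractPath_graph]
  ext y
  simp only [Graph.vertexSet_map, Graph.vertexSet_deleteEdges, Set.mem_image, moveVertex,
    Set.mem_sdiff, Set.mem_singleton_iff]
  constructor
  · rintro ⟨z, hz, rfl⟩
    split_ifs with h
    exacts [⟨h₂.right_mem, hb⟩, ⟨hz, h⟩]
  · rintro ⟨hy, hyx⟩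
    exact ⟨y, hy, by simp [hyx]⟩

lemma mem_edgeSet_contractPath {f : β} : f ∈ E((P.contractPath x b e₁ e₂).graph) ↔
    f ∈ E(P.graph) ∧ (P.graph.Inc f x → f = e₁) := by
  rw [contractPath_graph, mem_edgeSet_quotient]
  simp

/-- Only `b` has a second preimage, namely `x`, and it inherits the ends of `C` at `x`. -/
lemma degIn_contractPath (hV : V(P.graph).Finite) (hb : b ≠ x) (hx : x ∈ V(P.graph))
    (hbV : b ∈ V(P.graph)) {C : Finset β}
    (hC : (C : Set β) ⊆ E((P.contractPath x b e₁ e₂).graph)) {y : α}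
    (hy : y ∈ V(P.graph)) (hyx : y ≠ x) : degIn (P.contractPath x b e₁ e₂).graph C y =
      degIn P.graph C y + if y = b then degIn P.graph C x else 0 := by
  have h1 : ∀ f ∈ C, f ∈ E(P.graph) ∧ f ∉ P.graph.incidenceSet x \ {e₁} := fun f hf =>
    mem_edgeSet_quotient.1 (hC hf)
  rw [contractPath_graph, degIn_quotient hV (fun f hf => (h1 f hf).1) fun f hf => (h1 f hf).2]
  by_cases h : y = b
  · subst h
    rw [show hV.toFinset.filter (fun z => moveVertex x y z = y) = {y, x} by
      ext z
      rw [Finset.mem_filter]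
      simp only [moveVertex, Set.Finite.mem_toFinset, Finset.mem_insert, Finset.mem_singleton]
      by_cases hz : z = x
      · simp [hz, hx]
      · simp only [hz, if_false, or_false]
        exact ⟨fun h => h.2, fun h => ⟨h ▸ hbV, h⟩⟩]
    rw [Finset.sum_pair hyx]
    simp
  · rw [show hV.toFinset.filter (fun z => moveVertex x b z = y) = {y} by
      ext z
      rw [Finset.mem_filter]
      simp only [moveVertex, Set.Finite.mem_toFinset, Finset.mem_singleton]
      by_cases hz : z = x
      · simp only [hz, if_true]
        exact ⟨fun hh => absurd hh.2.symm h, fun hh => absurd hh.symm hyx⟩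
      · simp only [hz, if_false]
        exact ⟨fun h => h.2, fun h => ⟨h ▸ hy, h⟩⟩]
    simp [h]

lemma degIn_eq_one_of_contractPath (ha : a ≠ x) (h₁ : P.graph.IsLink e₁ x a) {C : Finset β}
    (hC : (C : Set β) ⊆ E((P.contractPath x b e₁ e₂).graph)) (he₁ : e₁ ∈ C) :
    degIn P.graph C x = 1 := by
  rw [← degIn_filter_inc, show C.filter (fun f => P.graph.Inc f x) = {e₁} by
    ext f
    simp only [Finset.mem_filter, Finset.mem_singleton]
    exact ⟨fun h => (mem_edgeSet_contractPath.1 (hC h.1)).2 h.2,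
      fun h => h ▸ ⟨he₁, h₁.inc_left⟩⟩]
  simp [degIn, endCount_eq_one h₁ ha]

/-- Hamiltonian cycles before and after the contraction of a path. -/
lemma isHam_contractPath_iff (hV : V(P.graph).Finite) (hne : e₁ ≠ e₂) (ha : a ≠ x) (hb : b ≠ x)
    (h₁ : P.graph.IsLink e₁ x a) (h₂ : P.graph.IsLink e₂ x b) {C : Finset β}
    (hC : (C : Set β) ⊆ E((P.contractPath x b e₁ e₂).graph)) (he₁ : e₁ ∈ C) :
    IsHam (P.contractPath x b e₁ e₂).graph C ↔ IsHam P.graph (insert e₂ C) := by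
  have he₂ : e₂ ∉ C := fun h =>
    hne ((mem_edgeSet_contractPath.1 (hC h)).2 h₂.inc_left).symm
  have hVC := vertexSet_contractPath (P := P) (e₁ := e₁) hb h₂
  have hdx := degIn_eq_one_of_contractPath ha h₁ hC he₁
  -- At `b` the moved end of `e₁` makes up for the missing end of `e₂`; elsewhere nothing changes.
  have hdeg : ∀ y ∈ V(P.graph), y ≠ x →
      degIn (P.contractPath x b e₁ e₂).graph C y = degIn P.graph (insert e₂ C) y := by
    intro y hy hyx
    rw [degIn_contractPath hV hb h₁.left_mem h₂.right_mem hC hy hyx, degIn_insert he₂,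
      endCount_of_isLink h₂, hdx]
    simp [hyx.symm, eq_comm, add_comm]
  have hdegx : degIn P.graph (insert e₂ C) x = 2 := by
    rw [degIn_insert he₂, hdx, endCount_eq_one h₂ hb]
  have hconn : ∀ u ∈ V(P.graph), ∀ v ∈ V(P.graph),
      Conn (P.contractPath x b e₁ e₂).graph C (moveVertex x b u) (moveVertex x b v) ↔
        Conn P.graph (↑(insert e₂ C)) u v := by
    intro u hu v hv
    rw [contractPath_graph]
    have hxb : Conn P.graph (↑(insert e₂ C)) x b := .of_isLink (f := e₂) (by simp) h₂
    refine conn_quotient_iff (fun f hf => (mem_edgeSet_quotient.1 (hC hf)).2)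
      (Finset.subset_insert _ _) ?_ ?_ hu hv
    · intro f hf hfC s t hst
      obtain rfl : f = e₂ := by simpa [hfC] using hf
      rcases h₂.eq_and_eq_or_eq_and_eq hst with ⟨rfl, rfl⟩ | ⟨rfl, rfl⟩ <;> simp [moveVertex]
    · intro s _ t _ hst
      unfold moveVertex at hst
      split_ifs at hst with hs ht ht
      · rw [hs, ht]; exact .refl
      · rw [hs, ← hst]; exact hxb
      · rw [hst, ht]; exact hxb.symm
      · rw [hst]; exact .refl
  constructor
  · intro h
    refine ⟨⟨x, h₁.left_mem⟩, ?_, ?_, ?_⟩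
    · intro f hf
      simp only [Finset.coe_insert, Set.mem_insert_iff] at hf
      rcases hf with rfl | hf
      exacts [h₂.edge_mem, (mem_edgeSet_contractPath.1 (hC hf)).1]
    · intro y hy
      by_cases hyx : y = x
      · rw [hyx, hdegx]
      · rw [← hdeg y hy hyx]
        exact h.degIn y (hVC ▸ ⟨hy, hyx⟩)
    · intro u hu v hv
      exact (hconn u hu v hv).1 (h.conn _ (by rw [contractPath_graph]; exact ⟨u, hu, rfl⟩) _
        (by rw [contractPath_graph]; exact ⟨v, hv, rfl⟩))
  · intro h
    refine ⟨⟨b, hVC ▸ ⟨h₂.right_mem, hb⟩⟩, hC, ?_, ?_⟩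
    · intro y hy
      rw [hVC] at hy
      rw [hdeg y hy.1 hy.2, h.degIn y hy.1]
    · intro u hu v hv
      rw [hVC] at hu hv
      have := (hconn u hu.1 v hv.1).2 (h.conn u hu.1 v hv.1)
      simpa [moveVertex, show u ≠ x from hu.2, show v ≠ x from hv.2] using this

/-- The degree could grow only at `b`, which gains the moved end of `e₁` but loses the end of `e₂`.
-/
lemma Problem.Valid.contractPath (hP : P.Valid) (hne : e₁ ≠ e₂) (ha : a ≠ x) (hb : b ≠ x)
    (h₁ : P.graph.IsLink e₁ x a) (h₂ : P.graph.IsLink e₂ x b)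
    (h : P.graph.incidenceSet x ∩ P.forced = {e₁, e₂}) : (P.contractPath x b e₁ e₂).Valid := by
  have hVC := vertexSet_contractPath (P := P) (e₁ := e₁) hb h₂
  refine ⟨?_, ?_, ?_, ?_, ?_⟩
  · rw [hVC]; exact hP.finite_vertexSet.sdiff
  · rw [hVC]; exact ⟨b, h₂.right_mem, hb⟩
  · exact hP.finite_edgeSet.subset fun f hf => (mem_edgeSet_contractPath.1 hf).1
  · intro y hy
    rw [hVC] at hy
    set C := hP.edges.filter fun f => P.graph.Inc f x → f = e₁ with hCdef
    have hC : (C : Set β) = E((P.contractPath x b e₁ e₂).graph) := by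
      ext f
      rw [mem_edgeSet_contractPath, ← hP.mem_edges]
      simp [hCdef]
    have he₁ : e₁ ∈ C := by simp [hCdef, hP.mem_edges, h₁.edge_mem]
    rw [degree_eq_degIn hC, degIn_contractPath hP.finite_vertexSet hb h₁.left_mem h₂.right_mem
      hC.le hy.1 hy.2, degIn_eq_one_of_contractPath ha h₁ hC.le he₁]
    by_cases hyb : y = b
    · have he₂ : e₂ ∉ C := by simp [hCdef, h₂.inc_left, hne.symm]
      have h3 := degIn_mono (G := P.graph) (C := insert e₂ C) (D := hP.edges)
        (Finset.insert_subset (hP.mem_edges.2 h₂.edge_mem) (Finset.filter_subset _ _)) b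
      rw [degIn_insert he₂, endCount_eq_one h₂.symm hb.symm] at h3
      have := hP.degIn_le h₂.right_mem
      simp [hyb]
      omega
    · have := degIn_mono (G := P.graph) (C := C) (D := hP.edges) (Finset.filter_subset _ _) y
      have := hP.degIn_le hy.1
      simp [hyb]
      omega
  · rintro f ⟨hf, hf₂⟩
    refine mem_edgeSet_contractPath.2 ⟨hP.forced_subset hf, fun hfx => ?_⟩
    have : f ∈ P.graph.incidenceSet x ∩ P.forced := ⟨hfx, hf⟩
    rw [h] at this
    exact this.resolve_right hf₂

lemma Problem.IsOptimum.contractPath (hP : P.Valid) (hne : e₁ ≠ e₂) (ha : a ≠ x) (hb : b ≠ x)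
    (h₁ : P.graph.IsLink e₁ x a) (h₂ : P.graph.IsLink e₂ x b)
    (h : P.graph.incidenceSet x ∩ P.forced = {e₁, e₂}) {r : Option ℝ} (hr : P.IsOptimum r) :
    (P.contractPath x b e₁ e₂).IsOptimum r := by
  have hP' := hP.contractPath hne ha hb h₁ h₂ h
  have heF : e₁ ∈ P.forced ∧ e₂ ∈ P.forced := by
    have := h.ge
    exact ⟨(this (by simp)).2, (this (by simp)).2⟩
  have hcost : ∀ C : Finset β, e₁ ∈ C → e₂ ∉ C →
      ∑ f ∈ C, (P.contractPath x b e₁ e₂).cost f = ∑ f ∈ insert e₂ C, P.cost f := by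
    intro C he₁ he₂
    rw [Finset.sum_insert he₂, ← Finset.sum_erase_add _ _ he₁, ← Finset.sum_erase_add C P.cost he₁]
    have : ∀ f ∈ C.erase e₁, (P.contractPath x b e₁ e₂).cost f = P.cost f := fun f hf => by
      simp [Problem.contractPath, Finset.ne_of_mem_erase hf]
    rw [Finset.sum_congr rfl this]
    simp [Problem.contractPath]
    ring
  refine hr.transfer hP.finite_vertexSet hP'.finite_vertexSet ?_ ?_
  · intro C hC
    -- The two forced edges exhaust the degree of a tour at `x`, so the contraction deletes no edge
    -- of the tour except `e₂`.
    have h2 : degIn P.graph {e₁, e₂} x = 2 := by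
      rw [degIn, Finset.sum_pair hne, endCount_eq_one h₁ ha, endCount_eq_one h₂ hb]
    have hsub : ({e₁, e₂} : Finset β) ⊆ C := by
      intro f hf
      simp only [Finset.mem_insert, Finset.mem_singleton] at hf
      rcases hf with rfl | rfl
      exacts [hC.2 heF.1, hC.2 heF.2]
    have he₁ : e₁ ∈ C := hsub (by simp)
    have he₂ : e₂ ∈ C := hsub (by simp)
    have hCE : (↑(C.erase e₂) : Set β) ⊆ E((P.contractPath x b e₁ e₂).graph) := by
      intro f hf
      simp only [Finset.coe_erase, Set.mem_sdiff, Finset.mem_coe, Set.mem_singleton_iff] at hf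
      refine mem_edgeSet_contractPath.2 ⟨hC.1.subset hf.1, fun hfx => ?_⟩
      have := mem_of_degIn_le hsub (by rw [h2, hC.1.degIn x h₁.left_mem]) hf.1 hfx
      simpa [hf.2] using this
    have he₁' : e₁ ∈ C.erase e₂ := Finset.mem_erase.2 ⟨hne, he₁⟩
    refine ⟨C.erase e₂, ⟨?_, ?_⟩, ?_⟩
    · rw [isHam_contractPath_iff hP.finite_vertexSet hne ha hb h₁ h₂ hCE he₁',
        Finset.insert_erase he₂]
      exact hC.1
    · rw [Finset.coe_erase]
      exact Set.sdiff_subset_sdiff_left hC.2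
    · rw [hcost _ he₁' (by simp), Finset.insert_erase he₂]
  · intro C hC
    have he₁ : e₁ ∈ C := hC.2 ⟨heF.1, hne⟩
    have he₂ : e₂ ∉ C := fun he₂ =>
      hne ((mem_edgeSet_contractPath.1 (hC.1.subset he₂)).2 h₂.inc_left).symm
    refine ⟨insert e₂ C, ⟨?_, ?_⟩, (hcost C he₁ he₂).ge⟩
    · rw [← isHam_contractPath_iff hP.finite_vertexSet hne ha hb h₁ h₂ hC.1.subset he₁]
      exact hC.1
    · intro f hf
      by_cases hf₂ : f = e₂
      · simp [hf₂]
      · have : f ∈ (C : Set β) := hC.2 ⟨hf, hf₂⟩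
        simp at this
        simp [this]

end ContractPath

/-! ### The Delta-Y step, step (i). -/

section ContractTriangle

variable {α β : Type*} {P : Problem α β} {w : Fin 3 → α} {e : Fin 3 → β}

/-- The map that merges the vertices of a triangle. -/
noncomputable def mergeTriangle (w : Fin 3 → α) (y : α) : α := if y ∈ Set.range w then w 0 else y

lemma contractTriangle_graph : (P.contractTriangle w e).graph =
    quotient P.graph (Set.range e) (mergeTriangle w) := rfl

lemma mergeTriangle_apply (i : Fin 3) : mergeTriangle w (w i) = w 0 := by simp [mergeTriangle]

lemma mergeTriangle_eq_iff {y z : α} :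
    mergeTriangle w y = mergeTriangle w z ↔ y = z ∨ y ∈ Set.range w ∧ z ∈ Set.range w := by
  unfold mergeTriangle
  split_ifs with hy hz hz
  · simp [hy, hz]
  · simp only [hy, hz, and_false, or_false]
    constructor
    · rintro rfl; exact absurd ⟨0, rfl⟩ hz
    · rintro rfl; exact absurd hy hz
  · simp only [hy, false_and, or_false]
    constructor
    · rintro rfl; exact absurd ⟨0, rfl⟩ hy
    · rintro rfl; exact absurd hz hy
  · simp [hy]

lemma vertexSet_contractTriangle (h : IsCycle P.graph w e) :
    V((P.contractTriangle w e).graph) = (V(P.graph) \ Set.range w) ∪ {w 0} := by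
  rw [contractTriangle_graph]
  ext y
  simp only [Graph.vertexSet_map, Graph.vertexSet_deleteEdges, Set.mem_image]
  constructor
  · rintro ⟨z, hz, rfl⟩
    unfold mergeTriangle
    split_ifs with hzw
    exacts [Or.inr rfl, Or.inl ⟨hz, hzw⟩]
  · rintro (⟨hy, hyw⟩ | rfl)
    · exact ⟨y, hy, by simp only [mergeTriangle, hyw, if_false]⟩
    · exact ⟨w 0, (h.2.2 0).left_mem, mergeTriangle_apply 0⟩

lemma degIn_contractTriangle_of_notMem (hV : V(P.graph).Finite) {C : Finset β}
    (hC : (C : Set β) ⊆ E((P.contractTriangle w e).graph)) {y : α} (hy : y ∈ V(P.graph))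
    (hyw : y ∉ Set.range w) : degIn (P.contractTriangle w e).graph C y = degIn P.graph C y := by
  have h1 : ∀ f ∈ C, f ∈ E(P.graph) ∧ f ∉ Set.range e := fun f hf =>
    mem_edgeSet_quotient.1 (hC hf)
  rw [contractTriangle_graph, degIn_quotient hV (fun f hf => (h1 f hf).1) fun f hf => (h1 f hf).2,
    show hV.toFinset.filter (fun z => mergeTriangle w z = y) = {y} by
      ext z
      have : mergeTriangle w y = y := if_neg hyw
      rw [Finset.mem_filter, ← this, mergeTriangle_eq_iff, Set.Finite.mem_toFinset, this,
        Finset.mem_singleton]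
      constructor
      · rintro ⟨_, h | h⟩
        exacts [h, absurd h.2 hyw]
      · rintro rfl
        exact ⟨hy, Or.inl rfl⟩]
  simp

lemma degIn_contractTriangle (hV : V(P.graph).Finite) (h : IsCycle P.graph w e) {C : Finset β}
    (hC : (C : Set β) ⊆ E((P.contractTriangle w e).graph)) :
    degIn (P.contractTriangle w e).graph C (w 0) = ∑ i, degIn P.graph C (w i) := by
  have h1 : ∀ f ∈ C, f ∈ E(P.graph) ∧ f ∉ Set.range e := fun f hf =>
    mem_edgeSet_quotient.1 (hC hf)
  rw [contractTriangle_graph, degIn_quotient hV (fun f hf => (h1 f hf).1) fun f hf => (h1 f hf).2,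
    show hV.toFinset.filter (fun z => mergeTriangle w z = w 0) = Finset.univ.image w by
      ext z
      rw [Finset.mem_filter, ← mergeTriangle_apply (w := w) 0, mergeTriangle_eq_iff,
        Set.Finite.mem_toFinset]
      simp only [Finset.mem_image, Finset.mem_univ, true_and]
      constructor
      · rintro ⟨_, h | h⟩
        exacts [⟨0, h.symm⟩, h.1]
      · rintro ⟨i, rfl⟩
        exact ⟨(h.2.2 i).left_mem, Or.inr ⟨⟨i, rfl⟩, ⟨0, rfl⟩⟩⟩]
  exact Finset.sum_image fun i _ j _ hij => h.1 hij

lemma degIn_sdiff_triangle (h : IsCycle P.graph w e) {C : Finset β}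
    (hC : Finset.univ.image e ⊆ C) (i : Fin 3) :
    degIn P.graph (C \ Finset.univ.image e) (w i) + 2 = degIn P.graph C (w i) := by
  rw [← h.degIn i, degIn_sdiff_add hC]

lemma image_cycle_subset (hP : P.Valid) {k : ℕ} [NeZero k] {w : Fin k → α} {e : Fin k → β}
    (h : IsCycle P.graph w e) : Finset.univ.image e ⊆ hP.edges := by
  intro f hf
  obtain ⟨i, rfl⟩ : ∃ i, e i = f := by simpa using hf
  exact hP.mem_edges.2 (h.2.2 i).edge_mem

lemma coe_edges_contractTriangle (hP : P.Valid) :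
    ((hP.edges \ Finset.univ.image e : Finset β) : Set β) =
      E((P.contractTriangle w e).graph) := by
  ext f
  rw [contractTriangle_graph, mem_edgeSet_quotient, ← hP.mem_edges]
  simp

/-- Each corner has degree at most 3, of which the triangle takes 2, so at most three ends meet at
the merged vertex. -/
lemma Problem.Valid.contractTriangle (hP : P.Valid) (h : IsCycle P.graph w e) :
    (P.contractTriangle w e).Valid := by
  have hVC := vertexSet_contractTriangle h
  have hE := coe_edges_contractTriangle (w := w) (e := e) hP
  refine ⟨?_, ?_, ?_, ?_, ?_⟩
  · rw [hVC]; exact hP.finite_vertexSet.sdiff.union (Set.finite_singleton _)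
  · rw [hVC]; exact ⟨w 0, Or.inr rfl⟩
  · rw [← hE]; exact Finset.finite_toSet _
  · intro y hy
    rw [degree_eq_degIn hE]
    rw [hVC] at hy
    rcases hy with ⟨hy, hyw⟩ | rfl
    · rw [degIn_contractTriangle_of_notMem hP.finite_vertexSet hE.le hy hyw]
      exact (degIn_mono Finset.sdiff_subset y).trans (hP.degIn_le hy)
    · rw [degIn_contractTriangle hP.finite_vertexSet h hE.le]
      have : ∀ i, degIn P.graph (hP.edges \ Finset.univ.image e) (w i) ≤ 1 := fun i => by
        have h1 := degIn_sdiff_triangle h (image_cycle_subset hP h) i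
        have h2 := hP.degIn_le (h.2.2 i).left_mem
        omega
      exact (Finset.sum_le_sum fun i _ => this i).trans (by simp)
  · rintro f ⟨hf, hfe⟩
    rw [contractTriangle_graph, mem_edgeSet_quotient]
    refine ⟨?_, hfe⟩
    rcases hf with hf | ⟨i, hi, _⟩
    exacts [hP.forced_subset hf, hi.edge_mem]

/-- The two edges are those at `w i`; they form the path through the triangle with middle vertex `w
i`. -/
lemma degIn_triangle_pair (h : IsCycle P.graph w e) (i j : Fin 3) :
    degIn P.graph {e i, e (i + 2)} (w j) = if j = i then 2 else 1 := by
  have hne : e i ≠ e (i + 2) := fun hh =>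
    (by decide : ∀ i : Fin 3, i ≠ i + 2) i (h.2.1 hh)
  rw [degIn, Finset.sum_pair hne, endCount_of_isLink (h.2.2 _), endCount_of_isLink (h.2.2 _)]
  simp only [h.1.eq_iff]
  fin_cases i <;> fin_cases j <;> decide

lemma eq_of_ne_add_one {i j : Fin 3} (h : j ≠ i + 1) : j = i ∨ j = i + 2 := by
  revert i j; decide

/-- Hamiltonian cycles before and after the contraction of a triangle. -/
lemma isHam_contractTriangle_iff (hV : V(P.graph).Finite) (h : IsCycle P.graph w e)
    {C : Finset β} (hC : (C : Set β) ⊆ E((P.contractTriangle w e).graph)) {i : Fin 3}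
    (hi : ∀ j, degIn P.graph C (w j) = if j = i then 0 else 1) :
    IsHam (P.contractTriangle w e).graph C ↔ IsHam P.graph (C ∪ {e i, e (i + 2)}) := by
  have h1 : ∀ f ∈ C, f ∈ E(P.graph) ∧ f ∉ Set.range e := fun f hf =>
    mem_edgeSet_quotient.1 (hC hf)
  have hVC := vertexSet_contractTriangle h
  have hdisj : Disjoint C {e i, e (i + 2)} := by
    rw [Finset.disjoint_left]
    intro f hf hfe
    refine (h1 f hf).2 ?_
    simp only [Finset.mem_insert, Finset.mem_singleton] at hfe
    rcases hfe with rfl | rfl <;> exact ⟨_, rfl⟩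
  have hdegw : ∀ j, degIn P.graph (C ∪ {e i, e (i + 2)}) (w j) = 2 := by
    intro j
    rw [degIn_union hdisj, hi, degIn_triangle_pair h]
    split_ifs <;> rfl
  have hdeg0 : degIn (P.contractTriangle w e).graph C (w 0) = 2 := by
    rw [degIn_contractTriangle hV h hC]
    simp only [hi]
    exact (by decide : ∀ i : Fin 3, (∑ j, if j = i then 0 else 1) = 2) i
  have hdeg : ∀ y ∈ V(P.graph), y ∉ Set.range w →
      degIn (P.contractTriangle w e).graph C y = degIn P.graph (C ∪ {e i, e (i + 2)}) y := by
    intro y hy hyw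
    have hz : ∀ j, endCount P.graph (e j) y = 0 := fun j => by
      rw [endCount_of_isLink (h.2.2 j)]
      have h1 : w j ≠ y := fun hh => hyw ⟨_, hh⟩
      have h2 : w (j + 1) ≠ y := fun hh => hyw ⟨_, hh⟩
      simp [h1, h2]
    have hz2 : degIn P.graph {e i, e (i + 2)} y = 0 := by
      refine Finset.sum_eq_zero fun f hf => ?_
      simp only [Finset.mem_insert, Finset.mem_singleton] at hf
      rcases hf with rfl | rfl <;> exact hz _
    rw [degIn_contractTriangle_of_notMem hV hC hy hyw, degIn_union hdisj, hz2, add_zero]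
  -- The restored path connects the three corners, as required of identified vertices in
  -- `conn_quotient_iff`.
  have hww : ∀ j, Conn P.graph (↑(C ∪ {e i, e (i + 2)})) (w i) (w j) := by
    intro j
    have ha : Conn P.graph (↑(C ∪ {e i, e (i + 2)})) (w i) (w (i + 1)) :=
      .of_isLink (f := e i) (by simp) (h.2.2 i)
    have hb : Conn P.graph (↑(C ∪ {e i, e (i + 2)})) (w i) (w (i + 2)) := by
      refine .of_isLink (f := e (i + 2)) (by simp) ?_
      have := (h.2.2 (i + 2)).symm
      rwa [show i + 2 + 1 = i from (by decide : ∀ i : Fin 3, i + 2 + 1 = i) i] at this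
    have := (by decide : ∀ i j : Fin 3, j = i ∨ j = i + 1 ∨ j = i + 2) i j
    rcases this with rfl | rfl | rfl
    exacts [.refl, ha, hb]
  have hconn : ∀ u ∈ V(P.graph), ∀ v ∈ V(P.graph),
      Conn (P.contractTriangle w e).graph C (mergeTriangle w u) (mergeTriangle w v) ↔
        Conn P.graph (↑(C ∪ {e i, e (i + 2)})) u v := by
    intro u hu v hv
    rw [contractTriangle_graph]
    refine conn_quotient_iff (fun f hf => (h1 f hf).2) Finset.subset_union_left ?_ ?_ hu hv
    · intro f hf hfC s t hst
      obtain ⟨j, rfl⟩ : f ∈ Set.range e := by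
        simp only [Finset.mem_union, hfC, Finset.mem_insert, Finset.mem_singleton,
          false_or] at hf
        rcases hf with rfl | rfl <;> exact ⟨_, rfl⟩
      rcases (h.2.2 j).eq_and_eq_or_eq_and_eq hst with ⟨rfl, rfl⟩ | ⟨rfl, rfl⟩ <;>
        simp only [mergeTriangle_apply]
    · intro s _ t _ hst
      rcases mergeTriangle_eq_iff.1 hst with rfl | ⟨⟨j, rfl⟩, ⟨l, rfl⟩⟩
      · exact .refl
      · exact (hww j).symm.trans (hww l)
  constructor
  · intro hH
    refine ⟨⟨w 0, (h.2.2 0).left_mem⟩, ?_, ?_, ?_⟩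
    · intro f hf
      simp only [Finset.coe_union, Finset.coe_insert, Finset.coe_singleton, Set.mem_union,
        Set.mem_insert_iff, Set.mem_singleton_iff] at hf
      rcases hf with hf | rfl | rfl
      exacts [(h1 f hf).1, (h.2.2 _).edge_mem, (h.2.2 _).edge_mem]
    · intro y hy
      by_cases hyw : y ∈ Set.range w
      · obtain ⟨j, rfl⟩ := hyw
        exact hdegw j
      · rw [← hdeg y hy hyw]
        exact hH.degIn y (hVC ▸ Or.inl ⟨hy, hyw⟩)
    · intro u hu v hv
      exact (hconn u hu v hv).1 (hH.conn _ (by rw [contractTriangle_graph]; exact ⟨u, hu, rfl⟩) _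
        (by rw [contractTriangle_graph]; exact ⟨v, hv, rfl⟩))
  · intro hH
    refine ⟨⟨w 0, hVC ▸ Or.inr rfl⟩, hC, ?_, ?_⟩
    · intro y hy
      rw [hVC] at hy
      rcases hy with ⟨hy, hyw⟩ | rfl
      · rw [hdeg y hy hyw, hH.degIn y hy]
      · exact hdeg0
    · intro u hu v hv
      rw [contractTriangle_graph] at hu hv
      obtain ⟨u, hu, rfl⟩ := hu
      obtain ⟨v, hv, rfl⟩ := hv
      exact (hconn u hu v hv).2 (hH.conn u hu v hv)

/-- A loop would contribute 2, so here each incident edge contributes exactly one end. -/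
lemma degIn_eq_card_of_le_one {G : Graph α β} {C : Finset β} {x : α} (h : degIn G C x ≤ 1) :
    (C.filter fun f => G.Inc f x).card = degIn G C x := by
  refine le_antisymm (card_inc_le_degIn C x) ?_
  by_contra! hlt
  have h0 : (C.filter fun f => G.Inc f x) = ∅ := Finset.card_eq_zero.1 (by omega)
  rw [← degIn_filter_inc, h0] at hlt
  simp [degIn] at hlt

/-- The costs of corresponding Hamiltonian cycles before and after the contraction of a
triangle. -/
lemma sum_cost_contractTriangle (h : IsCycle P.graph w e)
    {C : Finset β} (hC : (C : Set β) ⊆ E((P.contractTriangle w e).graph)) {i : Fin 3}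
    (hi : ∀ j, degIn P.graph C (w j) = if j = i then 0 else 1) :
    ∑ f ∈ C, (P.contractTriangle w e).cost f = ∑ f ∈ C ∪ {e i, e (i + 2)}, P.cost f := by
  have hdisj : Disjoint C {e i, e (i + 2)} := by
    rw [Finset.disjoint_left]
    intro f hf hfe
    refine (mem_edgeSet_quotient.1 (hC hf)).2 ?_
    simp only [Finset.mem_insert, Finset.mem_singleton] at hfe
    rcases hfe with rfl | rfl <;> exact ⟨_, rfl⟩
  have hne : e i ≠ e (i + 2) := fun hh =>
    (by decide : ∀ i : Fin 3, i ≠ i + 2) i (h.2.1 hh)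
  -- The extra charges occur at the corners `w (i + 1)` and `w (i + 2)` only. Modulo 3 they are the
  -- costs of `e (i + 2)` and `e i`, which are just the restored edges.
  have hj : ∀ j, ∑ f ∈ C, (if P.graph.Inc f (w j) then P.cost (e (j + 1)) else 0) =
      if j = i then 0 else P.cost (e (j + 1)) := by
    intro j
    rw [← Finset.sum_filter, Finset.sum_const, degIn_eq_card_of_le_one (by
      rw [hi]; split_ifs <;> simp), hi]
    split_ifs <;> simp
  rw [Finset.sum_union hdisj, Finset.sum_pair hne]
  have : ∀ f, (P.contractTriangle w e).cost f =
      P.cost f + ∑ i, if P.graph.Inc f (w i) then P.cost (e (i + 1)) else 0 := fun f => by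
    simp only [Problem.contractTriangle]
  simp only [this, Finset.sum_add_distrib]
  rw [Finset.sum_comm]
  simp only [hj]
  congr 1
  clear this hj hne hdisj hi hC
  fin_cases i <;> simp [Fin.sum_univ_three] <;> ring

/-- In a cubic graph, a Hamiltonian cycle uses exactly two edges of a triangle. -/
lemma exists_notMem_triangle (hP : P.Valid) (hdeg : ∀ x ∈ V(P.graph), degree P.graph x = 3)
    (h : IsCycle P.graph w e) {C : Finset β} (hC : IsHam P.graph C) :
    ∃ i, e i ∈ C ∧ e (i + 1) ∉ C ∧ e (i + 2) ∈ C ∧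
      ∀ j, degIn P.graph (C \ Finset.univ.image e) (w j) = if j = i then 0 else 1 := by
  have hE : ∀ j, degIn P.graph (hP.edges \ Finset.univ.image e) (w j) = 1 := fun j => by
    have h1 := degIn_sdiff_triangle h (image_cycle_subset hP h) j
    rw [← hP.degree_eq, hdeg _ (h.2.2 j).left_mem] at h1
    omega
  have hle : ∀ j, degIn P.graph (C \ Finset.univ.image e) (w j) ≤ 1 := fun j =>
    hE j ▸ degIn_mono (Finset.sdiff_subset_sdiff (hP.subset_edges hC.subset) subset_rfl) (w j)
  have hsplit : ∀ j, degIn P.graph (C \ Finset.univ.image e) (w j) +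
      degIn P.graph (C ∩ Finset.univ.image e) (w j) = 2 := fun j => by
    rw [← hC.degIn _ (h.2.2 j).left_mem, ← degIn_sdiff_add (D := C ∩ _) Finset.inter_subset_left,
      Finset.sdiff_inter_self_left]
  -- A tour containing the whole triangle would leave only three vertices, all of degree 3, and the
  -- degree sum 9 is odd.
  have hnot : ¬ ∀ j, e j ∈ C := by
    intro hall
    have hV := (hC.eq_of_isCycle h (by rintro _ ⟨j, rfl⟩; exact hall j)).1
    have heven := even_sum_degIn (G := P.graph) (C := hP.edges) hP.coe_edges.le
      (K := Finset.univ.image w) (fun f _ u v hl _ => by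
        have := hl.right_mem
        rw [← hV] at this
        simpa using this)
    rw [Finset.sum_image fun i _ j _ hij => h.1 hij] at heven
    simp only [← hP.degree_eq, hdeg _ (h.2.2 _).left_mem] at heven
    revert heven
    decide
  -- If both edges were missing, their common vertex `w (i + 1)` would have degree at most 1 in the
  -- tour, from its outer edge.
  have hnotmem : ∀ i, e i ∉ C → e (i + 1) ∈ C := by
    intro i hi
    by_contra hi1
    have : C ∩ Finset.univ.image e ⊆ {e (i + 2)} := by
      intro f hf
      obtain ⟨hfC, hfe⟩ := Finset.mem_inter.1 hf
      obtain ⟨j, rfl⟩ : ∃ j, e j = f := by simpa using hfe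
      have h1 : j ≠ i := fun hh => hi (hh ▸ hfC)
      have h2 : j ≠ i + 1 := fun hh => hi1 (hh ▸ hfC)
      simp [(eq_of_ne_add_one h2).resolve_left h1]
    have h3 := degIn_mono (G := P.graph) this (w (i + 1))
    have h4 : degIn P.graph {e (i + 2)} (w (i + 1)) = 0 := by
      simp only [degIn, Finset.sum_singleton, endCount_of_isLink (h.2.2 _), h.1.eq_iff]
      clear h3 this hi hi1
      revert i; decide
    have h5 := hsplit (i + 1)
    have h6 := hle (i + 1)
    omega
  push Not at hnot
  obtain ⟨i', hi'⟩ := hnot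
  obtain ⟨i, rfl⟩ : ∃ i, i' = i + 1 := ⟨i' - 1, by simp⟩
  have h2 : e (i + 2) ∈ C := by
    have := hnotmem _ hi'
    rwa [show i + 1 + 1 = i + 2 from (by decide : ∀ i : Fin 3, i + 1 + 1 = i + 2) i] at this
  have h0 : e i ∈ C := by
    by_contra hi
    exact hi' (hnotmem i hi)
  refine ⟨i, h0, hi', h2, fun j => ?_⟩
  have hint : C ∩ Finset.univ.image e = {e i, e (i + 2)} := by
    ext f
    simp only [Finset.mem_inter, Finset.mem_image, Finset.mem_univ, true_and, Finset.mem_insert,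
      Finset.mem_singleton]
    constructor
    · rintro ⟨hf, j, rfl⟩
      rcases eq_of_ne_add_one (i := i) (j := j) fun hh => hi' (hh ▸ hf) with rfl | rfl <;> simp
    · rintro (rfl | rfl)
      exacts [⟨h0, _, rfl⟩, ⟨h2, _, rfl⟩]
  have := hsplit j
  rw [hint, degIn_triangle_pair h] at this
  split_ifs at this ⊢ <;> omega

/-- In a cubic graph each corner has exactly one outer edge end. A tour uses it if and only if it
uses the opposite triangle edge, so the cost and the forcing of that edge can be recorded on the
outer edge. -/
lemma Problem.IsOptimum.contractTriangle (hP : P.Valid)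
    (hdeg : ∀ x ∈ V(P.graph), degree P.graph x = 3) (h : IsCycle P.graph w e) {r : Option ℝ}
    (hr : P.IsOptimum r) : (P.contractTriangle w e).IsOptimum r := by
  have hP' := hP.contractTriangle h
  have hE : ∀ j, degIn P.graph (hP.edges \ Finset.univ.image e) (w j) = 1 := fun j => by
    have h1 := degIn_sdiff_triangle h (image_cycle_subset hP h) j
    rw [← hP.degree_eq, hdeg _ (h.2.2 j).left_mem] at h1
    omega
  have hcoe := coe_edges_contractTriangle (w := w) (e := e) hP
  refine hr.transfer hP.finite_vertexSet hP'.finite_vertexSet ?_ ?_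
  · intro C hC
    obtain ⟨i, h0, h1, h2, hi⟩ := exists_notMem_triangle hP hdeg h hC.1
    have hsub : C \ Finset.univ.image e ⊆ hP.edges \ Finset.univ.image e :=
      Finset.sdiff_subset_sdiff (hP.subset_edges hC.1.subset) subset_rfl
    have hCE : (↑(C \ Finset.univ.image e) : Set β) ⊆ E((P.contractTriangle w e).graph) := by
      rw [← hcoe]
      exact_mod_cast hsub
    have hunion : C \ Finset.univ.image e ∪ {e i, e (i + 2)} = C := by
      ext f
      simp only [Finset.mem_union, Finset.mem_sdiff, Finset.mem_image, Finset.mem_univ, true_and,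
        Finset.mem_insert, Finset.mem_singleton]
      constructor
      · rintro (⟨hf, _⟩ | rfl | rfl)
        exacts [hf, h0, h2]
      · intro hf
        by_cases hfe : ∃ j, e j = f
        · obtain ⟨j, rfl⟩ := hfe
          rcases eq_of_ne_add_one (i := i) (j := j) fun hh => h1 (hh ▸ hf) with rfl | rfl <;> simp
        · exact Or.inl ⟨hf, hfe⟩
    refine ⟨C \ Finset.univ.image e, ⟨?_, ?_⟩, ?_⟩
    · rw [isHam_contractTriangle_iff hP.finite_vertexSet h hCE hi, hunion]
      exact hC.1
    · rintro f ⟨hf, hfe⟩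
      have hfe' : f ∉ Finset.univ.image e := by simpa using hfe
      rcases hf with hf | ⟨j, hj, hjF⟩
      · exact_mod_cast Finset.mem_sdiff.2 ⟨hC.2 hf, hfe'⟩
      -- The omitted triangle edge `e (i + 1)` is not forced, so the forced one is opposite to
      -- another corner, where the tour uses the only outer edge.
      · have hji : j ≠ i := by
          rintro rfl
          exact h1 (hC.2 hjF)
        exact_mod_cast mem_of_degIn_le (G := P.graph) hsub (x := w j)
          (by rw [hE, hi, if_neg hji])
          (Finset.mem_sdiff.2 ⟨hP.mem_edges.2 hj.edge_mem, hfe'⟩) hj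
    · rw [sum_cost_contractTriangle h hCE hi, hunion]
  · intro C hC
    have hsub : C ⊆ hP.edges \ Finset.univ.image e := by
      rw [← Finset.coe_subset, hcoe]
      exact hC.1.subset
    have hle : ∀ j, degIn P.graph C (w j) ≤ 1 := fun j => hE j ▸ degIn_mono hsub (w j)
    have hsum : ∑ j, degIn P.graph C (w j) = 2 := by
      rw [← degIn_contractTriangle hP.finite_vertexSet h hC.1.subset]
      refine hC.1.degIn _ ?_
      rw [vertexSet_contractTriangle h]
      exact Or.inr rfl
    obtain ⟨i, hi⟩ : ∃ i, ∀ j, degIn P.graph C (w j) = if j = i then 0 else 1 := by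
      have h0 := hle 0
      have h1 := hle 1
      have h2 := hle 2
      rw [Fin.sum_univ_three] at hsum
      rcases Nat.le_one_iff_eq_zero_or_eq_one.1 h0 with h0 | h0
      · exact ⟨0, fun j => by fin_cases j <;> simp <;> omega⟩
      · rcases Nat.le_one_iff_eq_zero_or_eq_one.1 h1 with h1 | h1
        · exact ⟨1, fun j => by fin_cases j <;> simp <;> omega⟩
        · exact ⟨2, fun j => by fin_cases j <;> simp <;> omega⟩
    refine ⟨C ∪ {e i, e (i + 2)}, ⟨?_, ?_⟩, (sum_cost_contractTriangle h hC.1.subset hi).ge⟩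
    · rw [← isHam_contractTriangle_iff hP.finite_vertexSet h hC.1.subset hi]
      exact hC.1
    · intro f hf
      by_cases hfe : f ∈ Set.range e
      · obtain ⟨j', rfl⟩ := hfe
        obtain ⟨j, rfl⟩ : ∃ j, j' = j + 1 := ⟨j' - 1, by simp⟩
        -- If the forced edge `e (j + 1)` were the omitted one, the outer edge at `w j` would have
        -- become forced, but the tour has no edge there.
        have hji : j ≠ i := by
          rintro rfl
          have hne : degIn P.graph (hP.edges \ Finset.univ.image e) (w j) ≠ 0 := by
            rw [hE]; simp
          obtain ⟨g, hg, hg0⟩ := Finset.exists_ne_zero_of_sum_ne_zero hne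
          have hgj : P.graph.Inc g (w j) := by
            by_contra hh
            exact hg0 (endCount_eq_zero hh)
          have hgC : g ∈ C := hC.2 ⟨Or.inr ⟨j, hgj, hf⟩, by
            simpa using (Finset.mem_sdiff.1 hg).2⟩
          have h1 := hi j
          rw [if_pos rfl] at h1
          have h2 := Finset.sum_eq_zero_iff.1 h1 g hgC
          exact hg0 h2
        have : e (j + 1) = e i ∨ e (j + 1) = e (i + 2) := by
          rcases eq_of_ne_add_one (i := i) (j := j + 1) fun hh => hji (add_right_cancel hh)
            with hh | hh <;> simp [hh]
        simp only [Finset.coe_union, Finset.coe_insert, Finset.coe_singleton, Set.mem_union,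
          Set.mem_insert_iff, Set.mem_singleton_iff]
        exact Or.inr this
      · have : f ∈ (C : Set β) := hC.2 ⟨Or.inl hf, hfe⟩
        rw [Finset.coe_union]
        exact Or.inl this

end ContractTriangle

/-! ### Forcing around a 4-cycle, step (j). -/

section Quad

variable {α β : Type*} {G : Graph α β} {P : Problem α β}

/-- The edges of a cycle that belong to `C` at a vertex of the cycle. -/
lemma IsCycle.degIn_inter {k : ℕ} [NeZero k] {w : Fin k → α} {e : Fin k → β} (h : IsCycle G w e)
    (C : Finset β) (i : Fin k) : ForcedTSP.degIn G (C ∩ Finset.univ.image e) (w i) =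
      (if e i ∈ C then 1 else 0) + (if e (i - 1) ∈ C then 1 else 0) := by
  have h1 : C ∩ Finset.univ.image e = (Finset.univ.filter fun j => e j ∈ C).image e := by
    ext f
    simp only [Finset.mem_inter, Finset.mem_image, Finset.mem_univ, true_and, Finset.mem_filter]
    constructor
    · rintro ⟨hf, j, rfl⟩
      exact ⟨j, hf, rfl⟩
    · rintro ⟨j, hf, rfl⟩
      exact ⟨hf, j, rfl⟩
  have h2 : ∀ j : Fin k, (j + 1 = i) = (j = i - 1) := fun j => by rw [eq_sub_iff_add_eq]
  rw [h1, ForcedTSP.degIn, Finset.sum_image fun a _ b _ hab => h.2.1 hab]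
  simp only [endCount_of_isLink (h.2.2 _), Finset.sum_add_distrib, h.1.eq_iff, h2,
    Finset.sum_ite_eq', Finset.mem_filter, Finset.mem_univ, true_and]

lemma IsCycle.degIn_eq {k : ℕ} [NeZero k] {w : Fin k → α} {e : Fin k → β} (h : IsCycle G w e)
    (C : Finset β) (i : Fin k) : ForcedTSP.degIn G C (w i) =
      ForcedTSP.degIn G (C \ Finset.univ.image e) (w i) +
        ((if e i ∈ C then 1 else 0) + (if e (i - 1) ∈ C then 1 else 0)) := by
  rw [← h.degIn_inter, ← degIn_sdiff_add (D := C ∩ _) Finset.inter_subset_left,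
    Finset.sdiff_inter_self_left]

lemma IsCycle.degIn_sdiff_le_one (hP : P.Valid) {k : ℕ} [NeZero k] {w : Fin k → α}
    {e : Fin k → β} (h : IsCycle P.graph w e) {C : Finset β} (hC : C ⊆ hP.edges) (i : Fin k) :
    ForcedTSP.degIn P.graph (C \ Finset.univ.image e) (w i) ≤ 1 := by
  refine (degIn_mono (Finset.sdiff_subset_sdiff hC subset_rfl) _).trans ?_
  have h1 := h.degIn i
  rw [← Finset.inter_eq_right.2 (image_cycle_subset hP h)] at h1
  have h2 := degIn_sdiff_add (G := P.graph) (C := hP.edges) (D := hP.edges ∩ Finset.univ.image e)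
    Finset.inter_subset_left (w i)
  rw [h1, Finset.sdiff_inter_self_left] at h2
  have := hP.degIn_le (h.2.2 i).left_mem
  omega

/-- A tour contains all edges leaving a 4-cycle two opposite vertices of which are touched. -/
lemma Problem.Tour.outerEdges_subset (hP : P.Valid) {w : Fin 4 → α} {e : Fin 4 → β}
    (h : P.IsUnforcedQuad w e) (h₀ : P.Touched (w 0)) (h₂ : P.Touched (w 2)) {C : Finset β}
    (hC : P.Tour C) : P.outerEdges w e ⊆ C := by
  obtain ⟨hcyc, hun⟩ := h
  have hsub := hP.subset_edges hC.1.subset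
  have hle := hcyc.degIn_sdiff_le_one hP hsub
  have hdeg : ∀ i, 2 = degIn P.graph (C \ Finset.univ.image e) (w i) +
      ((if e i ∈ C then 1 else 0) + (if e (i - 1) ∈ C then 1 else 0)) := fun i => by
    rw [← hcyc.degIn_eq, hC.1.degIn _ (hcyc.2.2 i).left_mem]
  have htouch : ∀ i, P.Touched (w i) → 1 ≤ degIn P.graph (C \ Finset.univ.image e) (w i) := by
    rintro i ⟨f, hf, hfi⟩
    refine (one_le_endCount hfi).trans (Finset.single_le_sum (f := fun f => endCount P.graph f (w i))
      (fun _ _ => Nat.zero_le _) (Finset.mem_sdiff.2 ⟨hC.2 hf, ?_⟩))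
    intro hfe
    obtain ⟨j, rfl⟩ : ∃ j, e j = f := by simpa using hfe
    exact hun j hf
  -- At `w 0` and `w 2` the tour has an outer edge and thus exactly one cycle edge, which makes two
  -- cycle edges in all. At `w 1` and `w 3` it needs at least one each, since only one outer edge is
  -- available there; so each gets exactly one and needs its outer edge too.
  have hpos : ∀ i, 1 ≤ degIn P.graph (C \ Finset.univ.image e) (w i) := by
    have t0 := htouch 0 h₀
    have t2 := htouch 2 h₂
    have d0 := hdeg 0
    have d1 := hdeg 1
    have d2 := hdeg 2
    have d3 := hdeg 3
    have l1 := hle 1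
    have l3 := hle 3
    rw [show (0 : Fin 4) - 1 = 3 by decide] at d0
    rw [show (1 : Fin 4) - 1 = 0 by decide] at d1
    rw [show (2 : Fin 4) - 1 = 1 by decide] at d2
    rw [show (3 : Fin 4) - 1 = 2 by decide] at d3
    have t1 : 1 ≤ degIn P.graph (C \ Finset.univ.image e) (w 1) := by
      split_ifs at d0 d1 d2 d3 <;> omega
    have t3 : 1 ≤ degIn P.graph (C \ Finset.univ.image e) (w 3) := by
      split_ifs at d0 d1 d2 d3 <;> omega
    intro i
    fin_cases i
    exacts [t0, t1, t2, t3]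
  rintro f ⟨⟨i, hi⟩, hfe⟩
  have hfe' : f ∉ Finset.univ.image e := by simpa using hfe
  exact Finset.sdiff_subset (mem_of_degIn_le (Finset.sdiff_subset_sdiff hsub subset_rfl)
    ((hcyc.degIn_sdiff_le_one hP subset_rfl i).trans (hpos i))
    (Finset.mem_sdiff.2 ⟨hP.mem_edges.2 hi.edge_mem, hfe'⟩) hi)

lemma Problem.outerEdges_subset (w : Fin 4 → α) (e : Fin 4 → β) :
    P.outerEdges w e ⊆ E(P.graph) := by
  rintro f ⟨⟨i, hi⟩, _⟩
  exact hi.edge_mem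

end Quad

/-! ### Structure of problems to which none of (a)-(h) applies. -/

section Irreducible

variable {α β : Type*} {P : Problem α β}

lemma degIn_eq_card_of_loopless {G : Graph α β} {C : Finset β} {x : α}
    (h : ∀ f ∈ C, ¬ G.IsLoopAt f x) : degIn G C x = (C.filter fun f => G.Inc f x).card := by
  rw [← degIn_filter_inc, Finset.card_eq_sum_ones]
  refine Finset.sum_congr rfl fun f hf => ?_
  rw [Finset.mem_filter] at hf
  simp [endCount, hf.2, h f hf.1]

lemma two_le_degree (hno : ∀ c, ¬ Reduce P c) {x : α} (hx : x ∈ V(P.graph)) :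
    2 ≤ degree P.graph x := by
  by_contra! h
  exact hno _ (.lowDegree x hx (by omega))

/-- At a single vertex all edges are loops, and a degree of 2 or 3 means exactly one loop. It is
forced by (b), and then (c) applies. -/
lemma one_lt_ncard_vertexSet (hP : P.Valid) (hno : ∀ c, ¬ Reduce P c) :
    1 < V(P.graph).ncard := by
  by_contra! hle
  obtain ⟨x, hx⟩ := hP.nonempty
  have hV : V(P.graph) = {x} := by
    have := Set.ncard_le_one hP.finite_vertexSet |>.1 hle
    ext y
    exact ⟨fun hy => this y hy x hx, fun hy => hy ▸ hx⟩
  have hloop : ∀ f ∈ E(P.graph), P.graph.IsLoopAt f x := by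
    intro f hf
    obtain ⟨u, v, h⟩ := Graph.exists_isLink_of_mem_edgeSet hf
    have hu : u = x := hV.le h.left_mem
    have hv : v = x := hV.le h.right_mem
    rwa [hu, hv] at h
  have hdeg : degree P.graph x = hP.edges.card * 2 := by
    rw [hP.degree_eq, degIn, Finset.sum_congr rfl fun f hf =>
      endCount_eq_two (hloop f (hP.mem_edges.1 hf))]
    simp
  have h1 := two_le_degree hno hx
  have h2 := hP.degree_le x hx
  have hcard : hP.edges.card = 1 := by omega
  obtain ⟨f, hf⟩ := Finset.card_eq_one.1 hcard
  have hE : E(P.graph) = {f} := by rw [← hP.coe_edges, hf]; simp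
  have hfx := hloop f (by rw [hE]; rfl)
  have hfF : f ∈ P.forced := by
    by_contra hfF
    exact hno _ (.degreeTwo x hx (by omega) fun h => hfF (h hfx.inc))
  refine hno _ (.hamiltonian ⟨1, inferInstance, fun _ => x, fun _ => f,
    ⟨Function.injective_of_subsingleton _, Function.injective_of_subsingleton _, fun _ => hfx⟩,
    by simp [hV], ?_⟩)
  refine Set.Subset.antisymm ?_ ?_
  · rintro _ ⟨_, rfl⟩
    exact hfF
  · intro g hg
    exact ⟨0, (hE.le (hP.forced_subset hg)).symm⟩

/-- A forced loop is a non-Hamiltonian cycle, excluded by (d); an unforced one would be removed by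
(h). Both need a second vertex. -/
lemma not_isLoopAt (hP : P.Valid) (hno : ∀ c, ¬ Reduce P c) (f : β) (x : α) :
    ¬ P.graph.IsLoopAt f x := by
  intro h
  have hV := one_lt_ncard_vertexSet hP hno
  by_cases hf : f ∈ P.forced
  · refine hno _ (.nonHamiltonian 1 (fun _ => x) (fun _ => f)
      ⟨Function.injective_of_subsingleton _, Function.injective_of_subsingleton _, fun _ => h⟩
      (by rintro _ ⟨_, rfl⟩; exact hf) fun hr => ?_)
    rw [← hr, Set.range_const, Set.ncard_singleton] at hV
    omega
  · exact hno _ (.loop x f h hf hV)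

lemma not_two_forced (hP : P.Valid) (hno : ∀ c, ¬ Reduce P c) {x : α} {e₁ e₂ : β}
    (hne : e₁ ≠ e₂) : P.graph.incidenceSet x ∩ P.forced ≠ {e₁, e₂} := by
  intro h
  obtain ⟨a, ha⟩ : P.graph.Inc e₁ x := (h.ge (by simp : e₁ ∈ ({e₁, e₂} : Set β))).1
  obtain ⟨b, hb⟩ : P.graph.Inc e₂ x := (h.ge (by simp : e₂ ∈ ({e₁, e₂} : Set β))).1
  refine hno _ (.path x a b e₁ e₂ hne ?_ ?_ ha hb h)
  · rintro rfl
    exact not_isLoopAt hP hno e₁ a ha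
  · rintro rfl
    exact not_isLoopAt hP hno e₂ b hb

/-- If no simplification step applies, then at most one forced edge is incident to a vertex. -/
lemma ncard_forced_le_one (hP : P.Valid) (hno : ∀ c, ¬ Reduce P c) (x : α) :
    (P.graph.incidenceSet x ∩ P.forced).ncard ≤ 1 := by
  by_contra! h
  have h2 : (P.graph.incidenceSet x ∩ P.forced).ncard ≤ 2 := by
    by_contra! h3
    exact hno _ (.claw x h3)
  obtain ⟨e₁, e₂, hne, h⟩ := Set.ncard_eq_two.1 (le_antisymm h2 h)
  exact not_two_forced hP hno hne h

lemma degree_eq_card (hP : P.Valid) (hno : ∀ c, ¬ Reduce P c) (x : α) :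
    degree P.graph x = (hP.edges.filter fun f => P.graph.Inc f x).card := by
  rw [hP.degree_eq, degIn_eq_card_of_loopless fun f _ => not_isLoopAt hP hno f x]

/-- If no simplification step applies, then the graph is cubic. -/
lemma degree_eq_three (hP : P.Valid) (hno : ∀ c, ¬ Reduce P c) {x : α} (hx : x ∈ V(P.graph)) :
    degree P.graph x = 3 := by
  have h1 := two_le_degree hno hx
  have h2 := hP.degree_le x hx
  by_contra hne
  have hd : degree P.graph x = 2 := by omega
  have hF : P.graph.incidenceSet x ⊆ P.forced := by
    by_contra h
    exact hno _ (.degreeTwo x hx hd h)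
  rw [degree_eq_card hP hno] at hd
  obtain ⟨e₁, e₂, hne, h⟩ := Finset.card_eq_two.1 hd
  refine not_two_forced hP hno (x := x) hne ?_
  rw [Set.inter_eq_left.2 hF]
  ext f
  have : f ∈ hP.edges.filter (fun f => P.graph.Inc f x) ↔ f = e₁ ∨ f = e₂ := by simp [h]
  rw [Finset.mem_filter, hP.mem_edges] at this
  rw [Set.mem_insert_iff, Set.mem_singleton_iff, ← this]
  exact ⟨fun hf => ⟨hf.edge_mem, hf⟩, fun hf => hf.2⟩

/-- If no simplification step applies, then every vertex is incident to an unforced edge. -/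
lemma exists_unforced (hP : P.Valid) (hno : ∀ c, ¬ Reduce P c) {x : α} (hx : x ∈ V(P.graph)) :
    ∃ f, P.graph.Inc f x ∧ f ∉ P.forced := by
  by_contra! h
  have h1 := degree_eq_three hP hno hx
  rw [degree_eq_card hP hno, ← Set.ncard_coe_finset] at h1
  have h2 : (↑(hP.edges.filter fun f => P.graph.Inc f x) : Set β) ⊆
      P.graph.incidenceSet x ∩ P.forced := by
    intro f hf
    have hf : P.graph.Inc f x := (Finset.mem_filter.1 hf).2
    exact ⟨hf, h f hf⟩
  have h3 := Set.ncard_le_ncard h2 (hP.finite_edgeSet.subset fun f hf => hf.1.edge_mem)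
  have := ncard_forced_le_one hP hno x
  omega

/-- The branching step can be performed if no simplification step applies. -/
lemma exists_branchEdge (hP : P.Valid) (hno : ∀ c, ¬ Reduce P c) : ∃ f, BranchEdge P f := by
  by_cases hq : ∃ w e, P.IsBranchQuad w e
  · obtain ⟨w, e, h⟩ := hq
    obtain ⟨i, hi⟩ : ∃ i, ¬ P.Touched (w i) := by
      by_contra! hall
      have := h.2
      rw [show {i | P.Touched (w i)} = Set.univ by ext; simp [hall], Set.ncard_univ] at this
      simp at this
    have hcyc := h.1.1
    have h1 := degree_eq_three hP hno (hcyc.2.2 i).left_mem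
    have h2 := hcyc.degIn_eq hP.edges i
    rw [hP.degree_eq] at h1
    -- The cycle takes only 2 of the degree 3 of `w i`. The remaining edge is unforced because `w i`
    -- is untouched.
    have h3 : degIn P.graph (hP.edges \ Finset.univ.image e) (w i) ≠ 0 := by
      split_ifs at h2 <;> omega
    obtain ⟨f, hf, hf0⟩ := Finset.exists_ne_zero_of_sum_ne_zero h3
    have hfi : P.graph.Inc f (w i) := by
      by_contra hh
      exact hf0 (endCount_eq_zero hh)
    exact ⟨f, .quad w e h i hi f hfi (fun hfF => hi ⟨f, hfF, hfi⟩)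
      (by simpa using (Finset.mem_sdiff.1 hf).2)⟩
  · push Not at hq
    rcases P.forced.eq_empty_or_nonempty with hF | ⟨g, hg⟩
    · obtain ⟨x, hx⟩ := hP.nonempty
      obtain ⟨f, hf, _⟩ := exists_unforced hP hno hx
      exact ⟨f, .initial hF f hf.edge_mem⟩
    · obtain ⟨y, z, hl⟩ := Graph.exists_isLink_of_mem_edgeSet (hP.forced_subset hg)
      obtain ⟨f, hf, hfF⟩ := exists_unforced hP hno hl.left_mem
      exact ⟨f, .forced hq g y hg hl.inc_left f hf hfF⟩

end Irreducible

/-! ### Spanning trees. -/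

section SpanningTrees

variable {α β : Type*} {G : Graph α β}

lemma isCycle_restrict_iff {k : ℕ} [NeZero k] {T : Set β} {w : Fin k → α} {e : Fin k → β} :
    IsCycle (G.restrict T) w e ↔ IsCycle G w e ∧ Set.range e ⊆ T := by
  simp only [IsCycle, Graph.restrict_isLink, Set.range_subset_iff, forall_and]
  tauto

/-- A finite connected graph contains a spanning tree. -/
lemma exists_isSpanningTree (hV : V(G).Nonempty) (S : Finset β) (hS : (S : Set β) ⊆ E(G))
    (hconn : ∀ x ∈ V(G), ∀ y ∈ V(G), Conn G S x y) :
    ∃ T : Finset β, T ⊆ S ∧ IsSpanningTree G T := by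
  induction S using Finset.strongInduction with
  | H S ih =>
    by_cases h : ∃ (k : ℕ) (_ : NeZero k) (w : Fin k → α) (e : Fin k → β),
        IsCycle (G.restrict S) w e
    · obtain ⟨k, _, w, e, hcyc⟩ := h
      obtain ⟨n, rfl⟩ := Nat.exists_eq_succ_of_ne_zero (NeZero.ne k)
      -- The last edge of the cycle can be dropped: the rest of the cycle still connects its ends.
      obtain ⟨hcyc, hsub⟩ := isCycle_restrict_iff.1 hcyc
      set f := e (Fin.last n)
      have hf : f ∈ S := hsub ⟨_, rfl⟩
      have hlast : Conn G (↑(S.erase f)) (w 0) (w (Fin.last n)) := by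
        refine (hcyc.conn_last (Fin.last n)).mono ?_
        rw [Finset.coe_erase]
        exact Set.sdiff_subset_sdiff_left hsub
      have hl : G.IsLink f (w (Fin.last n)) (w 0) := by
        have := hcyc.2.2 (Fin.last n)
        rwa [Fin.last_add_one] at this
      obtain ⟨T, hT, hTree⟩ := ih (S.erase f) (Finset.erase_ssubset hf)
        ((Finset.coe_subset.2 (Finset.erase_subset _ _)).trans hS) fun x hx y hy => by
          refine Conn.map (φ := id) (fun g hg u v hguv => ?_) (hconn x hx y hy)
          by_cases hgf : g = f
          · subst hgf
            rcases hl.eq_and_eq_or_eq_and_eq hguv with ⟨rfl, rfl⟩ | ⟨rfl, rfl⟩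
            exacts [hlast.symm, hlast]
          · exact .of_isLink (Finset.mem_coe.2 (Finset.mem_erase.2 ⟨hgf, hg⟩)) hguv
      exact ⟨T, hT.trans (Finset.erase_subset _ _), hTree⟩
    · push Not at h
      exact ⟨S, subset_rfl, hS, hV, fun x hx y hy => mem_component_iff.2 (hconn x hx y hy),
        fun k _ w e => h k inferInstance w e⟩

/-- The ends of an edge of a tree are not connected by other edges of the tree. -/
lemma IsSpanningTree.not_conn {T S : Set β} (hT : IsSpanningTree G T) {i : β} (hi : i ∈ T)
    (hS : S ⊆ T) (hiS : i ∉ S) {x y : α} (hl : G.IsLink i x y) : ¬ Conn G S x y := by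
  intro h
  obtain ⟨n, w, e, hcyc, hsub⟩ := exists_isCycle hiS hl h
  exact hT.2.2.2 (n + 1) w e (isCycle_restrict_iff.2
    ⟨hcyc, hsub.trans (Set.insert_subset hi hS)⟩)

/-- A path that uses `C` without `f` avoids also an edge `g` in another component. -/
lemma conn_of_conn_erase {C C' : Finset β} {f g : β} (hg : g ∈ C) {x y z z' : α}
    (hlg : G.IsLink g z z') (hxz : ¬ Conn G C x z)
    (hC' : ∀ h ∈ C, h ≠ f → h ≠ g → h ∈ C') (h : Conn G (↑(C.erase f)) x y) :
    Conn G C' x y := by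
  -- Connectivity in `C` is carried along to show that the walk stays in the component of `x`, which
  -- does not contain `g`.
  have key : Conn G C x y ∧ Conn G C' x y := by
    induction h with
    | refl => exact ⟨.refl, .refl⟩
    | @tail s t _ hl ih =>
      obtain ⟨h, hh, hl⟩ := hl
      obtain ⟨hhf, hhC⟩ := Finset.mem_erase.1 (Finset.mem_coe.1 hh)
      have hhg : h ≠ g := by
        rintro rfl
        rcases hlg.eq_and_eq_or_eq_and_eq hl with ⟨rfl, rfl⟩ | ⟨rfl, rfl⟩
        · exact hxz ih.1
        · exact hxz (ih.1.trans (.of_isLink hhC hl))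
      exact ⟨ih.1.trans (.of_isLink hhC hl), ih.2.trans (.of_isLink (hC' h hhC hhf hhg) hl)⟩
  exact key.2

end SpanningTrees

/-! ### Disjoint 4-cycles and minimum spanning trees of the patch graph. -/

section Patching

variable {α β : Type*} {P : Problem α β} {m : ℕ} {w : Fin m → Fin 4 → α} {e : Fin m → Fin 4 → β}

/-- The edges chosen on the `i`-th 4-cycle if the 4-cycles in `S` are switched. -/
noncomputable def switchPair (e : Fin m → Fin 4 → β) (S : Finset (Fin m)) (i : Fin m) : Finset β :=
  if i ∈ S then {e i 1, e i 3} else {e i 0, e i 2}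

/-- The forced edges together with one pair of opposite edges of each 4-cycle. -/
noncomputable def switched (F : Finset β) (e : Fin m → Fin 4 → β) (S : Finset (Fin m)) :
    Finset β :=
  F ∪ Finset.univ.biUnion (switchPair e S)

lemma mem_switched {F : Finset β} {S : Finset (Fin m)} {f : β} :
    f ∈ switched F e S ↔ f ∈ F ∨ ∃ i, f ∈ switchPair e S i := by
  simp [switched]

lemma coe_switched_empty {F : Finset β} (hF : (F : Set β) = P.forced) :
    (switched F e ∅ : Set β) = P.forced ∪ halves e := by
  simp [switched, switchPair, halves, hF]

lemma Problem.IsQuadCollection.edge_eq (h : P.IsQuadCollection w e) {i i' : Fin m} {j j' : Fin 4}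
    (he : e i j = e i' j') : i = i' ∧ j = j' := by
  have hi : i = i' := by
    by_contra hne
    have hl := (h.1 i).2.2 j
    rw [he] at hl
    refine Set.disjoint_left.1 (h.2.1 i i' hne) ⟨j, rfl⟩ ?_
    rcases hl.left_eq_or_eq ((h.1 i').2.2 j') with hh | hh
    exacts [⟨_, hh.symm⟩, ⟨_, hh.symm⟩]
  subst hi
  exact ⟨rfl, (h.1 i).2.1 he⟩

lemma Problem.IsQuadCollection.notMem_forced (h : P.IsQuadCollection w e) (i : Fin m)
    (j : Fin 4) : e i j ∉ P.forced :=
  (h.2.2.le (Set.mem_iUnion.2 ⟨i, j, rfl⟩)).2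

lemma Problem.IsQuadCollection.exists_eq (h : P.IsQuadCollection w e) {f : β}
    (hf : f ∈ E(P.graph)) (hfF : f ∉ P.forced) : ∃ i j, f = e i j := by
  obtain ⟨i, j, hij⟩ := Set.mem_iUnion.1 (h.2.2.ge ⟨hf, hfF⟩)
  exact ⟨i, j, hij.symm⟩

lemma Problem.IsQuadCollection.edge_mem_switched_iff (h : P.IsQuadCollection w e) {F : Finset β}
    (hF : (F : Set β) = P.forced) {S : Finset (Fin m)} {i : Fin m} {j : Fin 4} :
    e i j ∈ switched F e S ↔ if i ∈ S then j = 1 ∨ j = 3 else j = 0 ∨ j = 2 := by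
  have h1 : e i j ∉ F := by
    rw [← Finset.mem_coe, hF]
    exact h.notMem_forced i j
  rw [mem_switched]
  simp only [h1, false_or]
  constructor
  · rintro ⟨i', hi'⟩
    unfold switchPair at hi'
    by_cases hS : i' ∈ S
    · simp only [hS, if_true, Finset.mem_insert, Finset.mem_singleton] at hi'
      rcases hi' with hh | hh <;> obtain ⟨rfl, rfl⟩ := h.edge_eq hh <;> simp [hS]
    · simp only [hS, if_false, Finset.mem_insert, Finset.mem_singleton] at hi'
      rcases hi' with hh | hh <;> obtain ⟨rfl, rfl⟩ := h.edge_eq hh <;> simp [hS]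
  · intro hij
    refine ⟨i, ?_⟩
    unfold switchPair
    split_ifs at hij ⊢ with hS <;> rcases hij with rfl | rfl <;> simp

lemma Problem.IsQuadCollection.exists_vertex_eq (hP : P.Valid) (hno : ∀ c, ¬ Reduce P c)
    (h : P.IsQuadCollection w e) {x : α} (hx : x ∈ V(P.graph)) : ∃ i j, x = w i j := by
  obtain ⟨f, hfx, hfF⟩ := exists_unforced hP hno hx
  obtain ⟨i, j, rfl⟩ := h.exists_eq hfx.edge_mem hfF
  rcases hfx.eq_or_eq_of_isLink ((h.1 i).2.2 j) with hh | hh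
  exacts [⟨_, _, hh⟩, ⟨_, _, hh⟩]

/-- The summand 1 is the third edge at the vertex. An unforced one would belong to another 4-cycle,
but the 4-cycles are disjoint; so it is forced and lies in `C`. -/
lemma Problem.IsQuadCollection.degIn_eq (hP : P.Valid) (hno : ∀ c, ¬ Reduce P c)
    (h : P.IsQuadCollection w e) {C : Finset β} (hF : P.forced ⊆ C)
    (hC : (C : Set β) ⊆ E(P.graph)) (i : Fin m) (j : Fin 4) :
    degIn P.graph C (w i j) =
      1 + ((if e i j ∈ C then 1 else 0) + (if e i (j - 1) ∈ C then 1 else 0)) := by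
  have hcyc := h.1 i
  rw [hcyc.degIn_eq]
  congr 1
  refine le_antisymm (hcyc.degIn_sdiff_le_one hP (hP.subset_edges hC) j) ?_
  have h1 := degree_eq_three hP hno (hcyc.2.2 j).left_mem
  have h2 := hcyc.degIn_eq hP.edges j
  rw [hP.degree_eq] at h1
  have h3 : degIn P.graph (hP.edges \ Finset.univ.image (e i)) (w i j) ≠ 0 := by
    split_ifs at h2 <;> omega
  obtain ⟨f, hf, hf0⟩ := Finset.exists_ne_zero_of_sum_ne_zero h3
  rw [Finset.mem_sdiff, hP.mem_edges] at hf
  have hfj : P.graph.Inc f (w i j) := by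
    by_contra hh
    exact hf0 (endCount_eq_zero hh)
  have hfF : f ∈ P.forced := by
    by_contra hfF
    obtain ⟨i', j', rfl⟩ := h.exists_eq hf.1 hfF
    by_cases hi : i = i'
    · subst hi
      exact hf.2 (by simp)
    · refine Set.disjoint_left.1 (h.2.1 i i' hi) ⟨j, rfl⟩ ?_
      rcases hfj.eq_or_eq_of_isLink ((h.1 i').2.2 j') with hh | hh
      exacts [⟨_, hh.symm⟩, ⟨_, hh.symm⟩]
  exact (one_le_endCount hfj).trans (Finset.single_le_sum
    (f := fun f => endCount P.graph f (w i j)) (fun _ _ => Nat.zero_le _)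
    (Finset.mem_sdiff.2 ⟨hF hfF, hf.2⟩))

lemma forced_subset_switched {F : Finset β} (hF : (F : Set β) = P.forced) (S : Finset (Fin m)) :
    P.forced ⊆ switched F e S := by
  rw [← hF, Finset.coe_subset]
  exact Finset.subset_union_left

lemma Problem.IsQuadCollection.switched_subset (hP : P.Valid) (h : P.IsQuadCollection w e)
    {F : Finset β} (hF : (F : Set β) = P.forced) (S : Finset (Fin m)) :
    (switched F e S : Set β) ⊆ E(P.graph) := by
  intro f hf
  rcases mem_switched.1 (Finset.mem_coe.1 hf) with hf | ⟨i, hf⟩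
  · exact hP.forced_subset (hF.le hf)
  · obtain ⟨j, rfl⟩ : ∃ j, f = e i j := by
      unfold switchPair at hf
      split_ifs at hf <;> simp only [Finset.mem_insert, Finset.mem_singleton] at hf <;>
        rcases hf with rfl | rfl <;> exact ⟨_, rfl⟩
    exact ((h.1 i).2.2 j).edge_mem

lemma Problem.IsQuadCollection.degIn_switched (hP : P.Valid) (hno : ∀ c, ¬ Reduce P c)
    (h : P.IsQuadCollection w e) {F : Finset β} (hF : (F : Set β) = P.forced)
    (S : Finset (Fin m)) {x : α} (hx : x ∈ V(P.graph)) :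
    degIn P.graph (switched F e S) x = 2 := by
  obtain ⟨i, j, rfl⟩ := h.exists_vertex_eq hP hno hx
  rw [h.degIn_eq hP hno (forced_subset_switched hF S) (h.switched_subset hP hF S)]
  simp only [h.edge_mem_switched_iff hF]
  by_cases hS : i ∈ S
  · simp only [hS, if_true]
    exact (by decide : ∀ j : Fin 4, 1 + ((if j = 1 ∨ j = 3 then 1 else 0) +
      if j - 1 = 1 ∨ j - 1 = 3 then 1 else 0) = 2) j
  · simp only [hS, if_false]
    exact (by decide : ∀ j : Fin 4, 1 + ((if j = 0 ∨ j = 2 then 1 else 0) +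
      if j - 1 = 0 ∨ j - 1 = 2 then 1 else 0) = 2) j

/-- A tour uses a pair of opposite edges of each of the 4-cycles. -/
lemma Problem.IsQuadCollection.exists_eq_switched (hP : P.Valid) (hno : ∀ c, ¬ Reduce P c)
    (h : P.IsQuadCollection w e) {F : Finset β} (hF : (F : Set β) = P.forced) {C : Finset β}
    (hC : P.Tour C) : ∃ S, C = switched F e S := by
  refine ⟨Finset.univ.filter fun i => e i 0 ∉ C, ?_⟩
  have hdeg : ∀ i j, 2 = 1 + ((if e i j ∈ C then 1 else 0) + (if e i (j - 1) ∈ C then 1 else 0)) :=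
    fun i j => by
      rw [← h.degIn_eq hP hno hC.2 hC.1.subset, hC.1.degIn _ ((h.1 i).2.2 j).left_mem]
  -- One forced edge at each vertex leaves room for exactly one edge of the 4-cycle, so membership
  -- alternates and is determined by `e i 0`.
  have hstep : ∀ i j, e i (j + 1) ∈ C ↔ e i j ∉ C := by
    intro i j
    have := hdeg i (j + 1)
    rw [add_sub_cancel_right] at this
    split_ifs at this <;> simp_all
  have hmem : ∀ i j, e i j ∈ C ↔ if e i 0 ∉ C then j = 1 ∨ j = 3 else j = 0 ∨ j = 2 := by
    intro i j
    have h1 := hstep i 0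
    have h2 := hstep i 1
    have h3 := hstep i 2
    rw [show (0 : Fin 4) + 1 = 1 by decide] at h1
    rw [show (1 : Fin 4) + 1 = 2 by decide] at h2
    rw [show (2 : Fin 4) + 1 = 3 by decide] at h3
    by_cases h0 : e i 0 ∈ C <;> fin_cases j <;> simp_all
  ext f
  by_cases hfF : f ∈ P.forced
  · exact ⟨fun _ => forced_subset_switched hF _ hfF, fun _ => hC.2 hfF⟩
  · by_cases hfE : f ∈ E(P.graph)
    · obtain ⟨i, j, rfl⟩ := h.exists_eq hfE hfF
      rw [h.edge_mem_switched_iff hF, hmem]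
      simp
    · exact ⟨fun hf => absurd (hC.1.subset hf) hfE,
        fun hf => absurd (h.switched_subset hP hF _ hf) hfE⟩

/-- Translates tour costs into patch costs, so that comparing tours becomes comparing sets of
switched cycles. -/
lemma Problem.IsQuadCollection.sum_cost_switched (h : P.IsQuadCollection w e) {F : Finset β}
    (hF : (F : Set β) = P.forced) (S : Finset (Fin m)) :
    ∑ f ∈ switched F e S, P.cost f =
      ∑ f ∈ switched F e ∅, P.cost f + ∑ i ∈ S, P.patchCost e i := by
  have key : ∀ S, ∑ f ∈ switched F e S, P.cost f = ∑ f ∈ F, P.cost f +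
      ∑ i, (P.cost (e i 0) + P.cost (e i 2) + if i ∈ S then P.patchCost e i else 0) := by
    intro S
    have hex : ∀ i f, f ∈ switchPair e S i → ∃ j, f = e i j := by
      intro i f hf
      unfold switchPair at hf
      split_ifs at hf <;> simp only [Finset.mem_insert, Finset.mem_singleton] at hf <;>
        rcases hf with rfl | rfl <;> exact ⟨_, rfl⟩
    rw [switched, Finset.sum_union, Finset.sum_biUnion]
    · congr 1
      refine Finset.sum_congr rfl fun i _ => ?_
      have h13 : e i 1 ≠ e i 3 := fun hh => by simpa using (h.1 i).2.1 hh
      have h02 : e i 0 ≠ e i 2 := fun hh => by simpa using (h.1 i).2.1 hh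
      unfold switchPair
      split_ifs
      · rw [Finset.sum_pair h13, Problem.patchCost]
        ring
      · rw [Finset.sum_pair h02, add_zero]
    · intro i _ i' _ hne
      refine Finset.disjoint_left.2 fun f hf hf' => ?_
      obtain ⟨j, rfl⟩ := hex i f hf
      obtain ⟨j', hj'⟩ := hex i' _ hf'
      exact hne (h.edge_eq hj').1
    · refine Finset.disjoint_left.2 fun f hf hf' => ?_
      obtain ⟨i, _, hf'⟩ := Finset.mem_biUnion.1 hf'
      obtain ⟨j, rfl⟩ := hex i f hf'
      exact h.notMem_forced i j (hF.le hf)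
  rw [key S, key ∅]
  simp only [Finset.sum_add_distrib, Finset.sum_ite_mem, Finset.univ_inter, Finset.notMem_empty,
    if_false, Finset.sum_const_zero]
  ring

/-- The component of `x` in the graph formed by the forced edges and the cheap pairs. -/
def Problem.patchComponent (P : Problem α β) (e : Fin m → Fin 4 → β) (x : α) : Set α :=
  component (P.graph.restrict (P.forced ∪ halves e)) x

lemma Problem.patchComponent_eq_iff {x y : α} : P.patchComponent e x = P.patchComponent e y ↔
    Conn P.graph (P.forced ∪ halves e) x y := by
  constructor
  · intro h
    have hy : y ∈ P.patchComponent e y := mem_component_iff.2 .refl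
    rw [← h] at hy
    exact mem_component_iff.1 hy
  · intro h
    ext z
    exact ⟨fun hz => mem_component_iff.2 (h.symm.trans (mem_component_iff.1 hz)),
      fun hz => mem_component_iff.2 (h.trans (mem_component_iff.1 hz))⟩

lemma Problem.patchGraph_isLink_iff (h : P.IsQuadCollection w e) {i : Fin m} {A B : Set α} :
    (P.patchGraph w e).IsLink i A B ↔ A ≠ B ∧
      (A = P.patchComponent e (w i 0) ∧ B = P.patchComponent e (w i 2) ∨
        B = P.patchComponent e (w i 0) ∧ A = P.patchComponent e (w i 2)) := by
  have hmem : ∀ j, P.patchComponent e (w i j) ∈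
      component (P.graph.restrict (P.forced ∪ halves e)) '' V(P.graph) :=
    fun j => ⟨_, ((h.1 i).2.2 j).left_mem, rfl⟩
  have heq : ∀ A ∈ component (P.graph.restrict (P.forced ∪ halves e)) '' V(P.graph), ∀ x,
      x ∈ A ↔ A = P.patchComponent e x := by
    rintro _ ⟨y, _, rfl⟩ x
    change _ ↔ P.patchComponent e y = _
    rw [patchComponent_eq_iff, mem_component_iff]
  constructor
  · rintro ⟨hA, hB, hne, hh⟩
    rw [heq A hA, heq B hB, heq A hA, heq B hB] at hh
    exact ⟨hne, hh.imp id And.symm |>.imp id And.symm⟩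
  · rintro ⟨hne, ⟨rfl, rfl⟩ | ⟨rfl, rfl⟩⟩
    · exact ⟨hmem _, hmem _, hne, Or.inl ⟨mem_component_iff.2 .refl, mem_component_iff.2 .refl⟩⟩
    · exact ⟨hmem _, hmem _, hne, Or.inr ⟨mem_component_iff.2 .refl, mem_component_iff.2 .refl⟩⟩

/-- With `patchComponent_three`, this shows that a 4-cycle meets at most two components, those of `w
i 0` and `w i 2`. -/
lemma Problem.IsQuadCollection.patchComponent_one (h : P.IsQuadCollection w e) (i : Fin m) :
    P.patchComponent e (w i 0) = P.patchComponent e (w i 1) :=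
  patchComponent_eq_iff.2 (.of_isLink (f := e i 0)
    (Or.inr (Set.mem_iUnion.2 ⟨i, by simp⟩)) ((h.1 i).2.2 0))

lemma Problem.IsQuadCollection.patchComponent_three (h : P.IsQuadCollection w e) (i : Fin m) :
    P.patchComponent e (w i 2) = P.patchComponent e (w i 3) :=
  patchComponent_eq_iff.2 (.of_isLink (f := e i 2)
    (Or.inr (Set.mem_iUnion.2 ⟨i, by simp⟩)) ((h.1 i).2.2 2))

/-- Vertices connected after switching `S` lie in components connected by the edges in `S` of the
patch graph. -/
lemma Problem.IsQuadCollection.conn_patchGraph (h : P.IsQuadCollection w e)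
    {F : Finset β} (hF : (F : Set β) = P.forced) {S : Finset (Fin m)} {x y : α}
    (hxy : Conn P.graph (switched F e S) x y) :
    Conn (P.patchGraph w e) S (P.patchComponent e x) (P.patchComponent e y) := by
  refine Conn.map (φ := P.patchComponent e) (fun f hf u v hl => ?_) hxy
  by_cases hfF : f ∈ P.forced ∪ halves e
  · rw [patchComponent_eq_iff.2 (.of_isLink hfF hl)]
    exact .refl
  · have hf' := mem_switched.1 (Finset.mem_coe.1 hf)
    rw [← Finset.mem_coe, hF] at hf'
    obtain ⟨i, hi⟩ := hf'.resolve_left fun hh => hfF (Or.inl hh)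
    unfold switchPair at hi
    by_cases hS : i ∈ S
    · have h02 : Conn (P.patchGraph w e) S (P.patchComponent e (w i 0))
          (P.patchComponent e (w i 2)) := by
        by_cases hne : P.patchComponent e (w i 0) = P.patchComponent e (w i 2)
        · rw [hne]; exact .refl
        · exact .of_isLink hS ((patchGraph_isLink_iff h).2 ⟨hne, Or.inl ⟨rfl, rfl⟩⟩)
      have h1 := h.patchComponent_one i
      have h3 := h.patchComponent_three i
      simp only [hS, if_true, Finset.mem_insert, Finset.mem_singleton] at hi
      rcases hi with rfl | rfl
      · rcases ((h.1 i).2.2 1).eq_and_eq_or_eq_and_eq hl with ⟨rfl, rfl⟩ | ⟨rfl, rfl⟩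
        · rw [← h1]; exact h02
        · rw [← h1]; exact h02.symm
      · rcases ((h.1 i).2.2 3).eq_and_eq_or_eq_and_eq hl with ⟨rfl, rfl⟩ | ⟨rfl, rfl⟩
        · rw [← h3]; exact h02.symm
        · rw [← h3]; exact h02
    · simp only [hS, if_false, Finset.mem_insert, Finset.mem_singleton] at hi
      exact absurd (Or.inr (Set.mem_iUnion.2 ⟨i, by simpa using hi⟩)) hfF

/-- Switching a 4-cycle that joins two components merges them. -/
lemma Problem.IsQuadCollection.conn_switched_insert (hP : P.Valid) (hno : ∀ c, ¬ Reduce P c)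
    (h : P.IsQuadCollection w e) {F : Finset β} (hF : (F : Set β) = P.forced)
    {S : Finset (Fin m)} {i : Fin m} (hi : i ∉ S)
    (hnot : ¬ Conn P.graph (switched F e S) (w i 0) (w i 2)) :
    (∀ x y, Conn P.graph (switched F e S) x y → Conn P.graph (switched F e (insert i S)) x y) ∧
      Conn P.graph (switched F e (insert i S)) (w i 0) (w i 2) := by
  have l0 := (h.1 i).2.2 0
  have l2 := (h.1 i).2.2 2
  have l3 := (h.1 i).2.2 3
  rw [show (0 : Fin 4) + 1 = 1 by decide] at l0
  rw [show (2 : Fin 4) + 1 = 3 by decide] at l2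
  rw [show (3 : Fin 4) + 1 = 0 by decide] at l3
  have m0 : e i 0 ∈ switched F e S := by rw [h.edge_mem_switched_iff hF]; simp [hi]
  have m2 : e i 2 ∈ switched F e S := by rw [h.edge_mem_switched_iff hF]; simp [hi]
  have m3 : e i 3 ∈ switched F e (insert i S) := by rw [h.edge_mem_switched_iff hF]; simp
  have hsub : ∀ g ∈ switched F e S, g ≠ e i 0 → g ≠ e i 2 → g ∈ switched F e (insert i S) := by
    intro g hg h0 h2
    rw [mem_switched] at hg ⊢
    refine hg.imp id ?_
    rintro ⟨i', hi'⟩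
    refine ⟨i', ?_⟩
    have hne : i' ≠ i := by
      rintro rfl
      simp [switchPair, hi, h0, h2] at hi'
    simpa [switchPair, hne] using hi'
  -- All degrees are 2, hence even, so no edge is a bridge.
  have hpar : ∀ f ∈ switched F e S, ∀ x y, P.graph.IsLink f x y →
      Conn P.graph (↑((switched F e S).erase f)) x y := fun f hf x y hl =>
    conn_erase_of_even (h.switched_subset hP hF S) hP.finite_vertexSet
      (fun x hx => by simp [h.degIn_switched hP hno hF S hx]) hf hl
  -- A detour around `e i 0` stays in its component, so it also avoids `e i 2` and survives the
  -- switch. The same holds with the two edges exchanged.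
  have c01 : Conn P.graph (switched F e (insert i S)) (w i 0) (w i 1) :=
    conn_of_conn_erase m2 l2 hnot hsub (hpar _ m0 _ _ l0)
  have c23 : Conn P.graph (switched F e (insert i S)) (w i 2) (w i 3) :=
    conn_of_conn_erase m0 l0 (fun hh => hnot hh.symm) (fun g hg h2 h0 => hsub g hg h0 h2)
      (hpar _ m2 _ _ l2)
  refine ⟨fun x y hxy => ?_, (c23.trans (.of_isLink m3 l3)).symm⟩
  refine Conn.map (φ := id) (fun g hg u v hl => ?_) hxy
  by_cases h0 : g = e i 0
  · subst h0
    rcases l0.eq_and_eq_or_eq_and_eq hl with ⟨rfl, rfl⟩ | ⟨rfl, rfl⟩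
    exacts [c01, c01.symm]
  by_cases h2 : g = e i 2
  · subst h2
    rcases l2.eq_and_eq_or_eq_and_eq hl with ⟨rfl, rfl⟩ | ⟨rfl, rfl⟩
    exacts [c23, c23.symm]
  exact .of_isLink (hsub g hg h0 h2) hl

/-- Switching edges of a spanning tree of the patch graph merges the components that they join. -/
lemma Problem.IsQuadCollection.conn_switched (hP : P.Valid) (hno : ∀ c, ¬ Reduce P c)
    (h : P.IsQuadCollection w e) {F : Finset β} (hF : (F : Set β) = P.forced) {T : Set (Fin m)}
    (hT : IsSpanningTree (P.patchGraph w e) T) (S : Finset (Fin m)) (hS : (S : Set (Fin m)) ⊆ T)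
    {x y : α} (hxy : Conn (P.patchGraph w e) S (P.patchComponent e x) (P.patchComponent e y)) :
    Conn P.graph (switched F e S) x y := by
  induction S using Finset.induction_on generalizing x y with
  | empty =>
    rw [coe_switched_empty hF, ← patchComponent_eq_iff]
    rcases hxy.cases_tail with hh | ⟨_, _, f, hf, _⟩
    · exact hh.symm
    · simp at hf
  | insert i S hi ih =>
    rw [Finset.coe_insert, Set.insert_subset_iff] at hS
    obtain ⟨A, B, hAB⟩ := Graph.exists_isLink_of_mem_edgeSet (hT.1 hS.1)
    have hl : (P.patchGraph w e).IsLink i (P.patchComponent e (w i 0))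
        (P.patchComponent e (w i 2)) := by
      obtain ⟨_, ⟨rfl, rfl⟩ | ⟨rfl, rfl⟩⟩ := (patchGraph_isLink_iff h).1 hAB
      exacts [hAB, hAB.symm]
    -- If `w i 0` and `w i 2` were already connected, edges in `S` would connect their components in
    -- the patch graph and close a cycle with the tree edge `i`.
    obtain ⟨hmono, h02⟩ := h.conn_switched_insert hP hno hF hi fun hh =>
      hT.not_conn hS.1 hS.2 (by simpa using hi) hl (h.conn_patchGraph hF hh)
    have hsame : ∀ u v, P.patchComponent e u = P.patchComponent e v →
        Conn P.graph (switched F e (insert i S)) u v := fun u v huv =>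
      hmono u v (ih hS.2 (huv ▸ .refl))
    have key : ∀ B, Conn (P.patchGraph w e) (↑(insert i S)) (P.patchComponent e x) B →
        ∀ y, P.patchComponent e y = B → Conn P.graph (switched F e (insert i S)) x y := by
      intro B hB
      induction hB with
      | refl => exact fun y hy => hsame x y hy.symm
      | @tail A B _ hl ihB =>
        rintro y rfl
        obtain ⟨j, hj, hlj⟩ := hl
        obtain ⟨a, _, rfl⟩ := hlj.left_mem
        refine (ihB a rfl).trans ?_
        rcases Finset.mem_insert.1 (Finset.mem_coe.1 hj) with rfl | hj
        · obtain ⟨_, ⟨ha, hb⟩ | ⟨hb, ha⟩⟩ := (patchGraph_isLink_iff h).1 hlj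
          · exact ((hsame a _ ha).trans h02).trans (hsame _ y hb.symm)
          · exact ((hsame a _ ha).trans h02.symm).trans (hsame _ y hb.symm)
        · exact hmono a y (ih hS.2 (.of_isLink hj hlj))
    exact key _ hxy y rfl

/-- Every tour is obtained by switching a set of 4-cycles that contains a spanning tree of the patch
graph. -/
lemma Problem.IsQuadCollection.exists_isSpanningTree (hP : P.Valid) (hno : ∀ c, ¬ Reduce P c)
    (h : P.IsQuadCollection w e) {F : Finset β} (hF : (F : Set β) = P.forced) {C : Finset β}
    (hC : P.Tour C) : ∃ S T : Finset (Fin m), C = switched F e S ∧ T ⊆ S ∧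
      IsSpanningTree (P.patchGraph w e) T := by
  obtain ⟨S, rfl⟩ := h.exists_eq_switched hP hno hF hC
  -- A switched 4-cycle inside a single component gives no edge of the patch graph and is filtered
  -- out.
  obtain ⟨T, hT, hTree⟩ := ForcedTSP.exists_isSpanningTree (G := P.patchGraph w e)
    (hP.nonempty.image _) (S.filter fun i => i ∈ E(P.patchGraph w e))
    (fun i hi => (Finset.mem_filter.1 hi).2) (by
      rintro _ ⟨x, hx, rfl⟩ _ ⟨y, hy, rfl⟩
      refine Conn.map (φ := id) (fun i hi A B hl => ?_)
        (h.conn_patchGraph hF (hC.1.conn x hx y hy))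
      exact .of_isLink (Finset.mem_coe.2 (Finset.mem_filter.2 ⟨hi, hl.edge_mem⟩)) hl)
  exact ⟨S, T, rfl, hT.trans (Finset.filter_subset _ _), hTree⟩

/-- The step for disjoint 4-cycles of unforced edges returns the optimum. -/
lemma Patch.isOptimum (hP : P.Valid) (hno : ∀ c, ¬ Reduce P c) {r : Option ℝ} (hr : Patch P r) :
    P.IsOptimum r := by
  obtain ⟨F, hF⟩ : ∃ F : Finset β, (F : Set β) = P.forced :=
    ⟨(hP.finite_edgeSet.subset hP.forced_subset).toFinset, Set.Finite.coe_toFinset _⟩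
  cases hr with
  | @tree m w e h hH T hT =>
    obtain ⟨T, rfl⟩ : ∃ T' : Finset (Fin m), (T' : Set (Fin m)) = T := ⟨T.toFinset, by simp⟩
    rw [Problem.isOptimum_some_iff hP.finite_vertexSet, ← coe_switched_empty hF, totalCost_coe,
      totalCost_coe, ← h.sum_cost_switched hF]
    refine ⟨⟨_, ⟨⟨hP.nonempty, h.switched_subset hP hF T, fun x hx =>
      h.degIn_switched hP hno hF T hx, fun x hx y hy => ?_⟩, forced_subset_switched hF T⟩, rfl⟩, ?_⟩
    · exact h.conn_switched hP hno hF hT.1 T subset_rfl (mem_component_iff.1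
        (hT.1.2.2.1 _ ⟨x, hx, rfl⟩ _ ⟨y, hy, rfl⟩))
    · intro C hC
      obtain ⟨S, T', rfl, hTS, hT'⟩ := h.exists_isSpanningTree hP hno hF hC
      rw [h.sum_cost_switched hF, h.sum_cost_switched hF S]
      have h1 := hT.2 _ hT'
      rw [totalCost_coe, totalCost_coe] at h1
      -- Cycles switched beyond the tree do not lower the cost, because each `H i` is the cheaper
      -- pair.
      have h2 : ∑ i ∈ T', P.patchCost e i ≤ ∑ i ∈ S, P.patchCost e i :=
        Finset.sum_le_sum_of_subset_of_nonneg hTS fun i _ _ => sub_nonneg.2 (hH i)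
      linarith
  | noTree w e h hH hT =>
    rw [Problem.isOptimum_none_iff hP.finite_vertexSet]
    intro C hC
    obtain ⟨_, T, _, _, hT'⟩ := h.exists_isSpanningTree hP hno hF hC
    exact hT _ hT'

lemma IsCycle.rotate {k : ℕ} [NeZero k] {G : Graph α β} {w : Fin k → α} {e : Fin k → β}
    (h : IsCycle G w e) (s : Fin k) : IsCycle G (fun j => w (j + s)) (fun j => e (j + s)) := by
  refine ⟨fun a b hab => add_right_cancel (h.1 hab), fun a b hab => add_right_cancel (h.2.1 hab),
    fun j => ?_⟩
  have := h.2.2 (j + s)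
  rwa [add_right_comm] at this

/-- The step for disjoint 4-cycles of unforced edges can be performed whenever it applies. -/
lemma Problem.IsQuadCollection.exists_patch (h : P.IsQuadCollection w e) : ∃ r, Patch P r := by
  -- Rotating a 4-cycle by one exchanges its two pairs of opposite edges, which puts the cheaper
  -- pair at positions 0 and 2.
  set s : Fin m → Fin 4 := fun i =>
    if P.cost (e i 0) + P.cost (e i 2) ≤ P.cost (e i 1) + P.cost (e i 3) then 0 else 1
  set w' : Fin m → Fin 4 → α := fun i j => w i (j + s i)
  set e' : Fin m → Fin 4 → β := fun i j => e i (j + s i)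
  have h' : P.IsQuadCollection w' e' := by
    refine ⟨fun i => (h.1 i).rotate (s i), fun i j hij => ?_, ?_⟩
    · have h1 : Set.range (w' i) = Set.range (w i) := (Equiv.addRight (s i)).surjective.range_comp _
      have h2 : Set.range (w' j) = Set.range (w j) := (Equiv.addRight (s j)).surjective.range_comp _
      rw [h1, h2]
      exact h.2.1 i j hij
    · rw [← h.2.2]
      exact Set.iUnion_congr fun i => (Equiv.addRight (s i)).surjective.range_comp _
  have hH : ∀ i, P.cost (e' i 0) + P.cost (e' i 2) ≤ P.cost (e' i 1) + P.cost (e' i 3) := by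
    intro i
    by_cases hc : P.cost (e i 0) + P.cost (e i 2) ≤ P.cost (e i 1) + P.cost (e i 3)
    · simp [e', s, hc]
    · have h1 : s i = 1 := by simp [s, hc]
      simp only [e', h1, show (0 : Fin 4) + 1 = 1 by decide, show (1 : Fin 4) + 1 = 2 by decide,
        show (2 : Fin 4) + 1 = 3 by decide, show (3 : Fin 4) + 1 = 0 by decide]
      linarith
  by_cases hT : ∃ T, IsSpanningTree (P.patchGraph w' e') T
  · obtain ⟨T, hT, hmin⟩ := Set.exists_min_image {T | IsSpanningTree (P.patchGraph w' e') T}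
      (fun T => totalCost (P.patchCost e') T) (Set.toFinite _) hT
    exact ⟨_, .tree w' e' h' hH T ⟨hT, hmin⟩⟩
  · push Not at hT
    exact ⟨_, .noTree w' e' h' hH hT⟩

end Patching

/-! ### Invariance of the value, and progress. -/

section Execution

variable {α β : Type*} {P P' : Problem α β}

/-- The value that a configuration should return. -/
inductive Config.Value : Config α β → Option ℝ → Prop
  | call {P : Problem α β} {r : Option ℝ} (hP : P.Valid) (h : P.IsOptimum r) :
      Config.Value (.call P) r
  | fork {c d : Config α β} {r s : Option ℝ} (hc : Config.Value c r) (hd : Config.Value d s) :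
      Config.Value (.fork c d) (Option.merge min r s)
  | ret (r : Option ℝ) : Config.Value (.ret r) r

lemma Problem.Valid.value_ret (hP : P.Valid) {r s : Option ℝ} (hr : P.IsOptimum r)
    (hs : P.IsOptimum s) : (Config.ret s : Config α β).Value r := by
  rw [hP.isOptimum_unique hr hs]
  exact .ret s

lemma Reduce.value (hP : P.Valid) {c : Config α β} (h : Reduce P c) {r : Option ℝ}
    (hr : P.IsOptimum r) : c.Value r := by
  cases h with
  | lowDegree x hx hd => exact hP.value_ret hr (P.isOptimum_none_of_degree_le_one hP hx hd)
  | degreeTwo x hx hd hnew =>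
    exact .call (hP.force (P.graph.incidenceSet_subset_edgeSet x))
      (hr.force hP fun C hC => hC.incidenceSet_subset hP hx hd)
  | hamiltonian h => exact hP.value_ret hr (P.isOptimum_forced hP h)
  | nonHamiltonian k w e h hF hne =>
    exact hP.value_ret hr (P.isOptimum_none_of_isCycle hP h hF hne)
  | claw x h => exact hP.value_ret hr (P.isOptimum_none_of_claw hP h)
  | path x a b e₁ e₂ hne ha hb h₁ h₂ h =>
    exact .call (hP.contractPath hne ha hb h₁ h₂ h) (hr.contractPath hP hne ha hb h₁ h₂ h)
  | parallel x y f g hne hf hg hV hfF h =>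
    exact .call (hP.delete hfF) (hr.delete_parallel hP hne hf hg hV hfF h)
  | loop x f hf hfF hV => exact .call (hP.delete hfF) (hr.delete_loop hP hf hV)

lemma Simplify.value (hP : P.Valid) {c : Config α β} (h : Simplify P c) {r : Option ℝ}
    (hr : P.IsOptimum r) : c.Value r := by
  cases h with
  | reduce c h => exact h.value hP hr
  | triangle hno w e h =>
    exact .call (hP.contractTriangle h)
      (hr.contractTriangle hP (fun x hx => degree_eq_three hP hno hx) h)
  | quad w e h h₀ h₂ hnew =>
    exact .call (hP.force (P.outerEdges_subset w e))
      (hr.force hP fun C hC => hC.outerEdges_subset hP h h₀ h₂)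

lemma BranchEdge.mem {f : β} (h : BranchEdge P f) :
    f ∈ E(P.graph) ∧ f ∉ P.forced := by
  cases h with
  | quad w e h i hi _ hf hfF hfe => exact ⟨hf.edge_mem, hfF⟩
  | forced hno g y hgF hg _ hf hfF => exact ⟨hf.edge_mem, hfF⟩
  | initial hF _ hf => exact ⟨hf, by simp [hF]⟩

/-- The value of a configuration is preserved by the steps of the algorithm. -/
lemma Step.value {c c' : Config α β} (h : Step c c') : ∀ {r}, c.Value r → c'.Value r := by
  induction h with
  | simplify P c h =>
    rintro r ⟨hP, hr⟩
    exact h.value hP hr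
  | patch P s hs h =>
    rintro r ⟨hP, hr⟩
    exact hP.value_ret hr (h.isOptimum hP fun c hc => hs c (.reduce c hc))
  | branch P f hs hq h =>
    rintro r ⟨hP, hr⟩
    obtain ⟨hfE, hfF⟩ := h.mem
    have h1 := hP.force (A := {f}) (by simpa using hfE)
    have h2 := hP.delete hfF
    -- Both branches are valid and so have optima; the smaller one is an optimum of `P`, and thus
    -- equals `r` by uniqueness.
    obtain ⟨s, hs⟩ := h1.exists_isOptimum
    obtain ⟨t, ht⟩ := h2.exists_isOptimum
    rw [hP.isOptimum_unique hr (Problem.IsOptimum.merge hP f hs ht)]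
    exact .fork (.call h1 hs) (.call h2 ht)
  | first c c' d _ ih =>
    rintro _ ⟨⟩
    rename_i hc hd
    exact .fork (ih hc) hd
  | second r d d' _ ih =>
    rintro _ ⟨⟩
    rename_i hc hd
    exact .fork hc (ih hd)
  | join r s =>
    rintro _ ⟨⟩
    rename_i hc hd
    cases hc
    cases hd
    exact .ret _

/-- A configuration that has not returned its value can perform a step. -/
lemma Config.Value.exists_step {c : Config α β} {r : Option ℝ} (h : c.Value r) :
    c = .ret r ∨ ∃ c', Step c c' := by
  induction h with
  | ret r => exact Or.inl rfl
  | @call P r hP hr =>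
    refine Or.inr ?_
    by_cases hs : ∃ c, Simplify P c
    · obtain ⟨c, hc⟩ := hs
      exact ⟨c, .simplify P c hc⟩
    · push Not at hs
      by_cases hq : ∃ (m : ℕ) (w : Fin m → Fin 4 → α) (e : Fin m → Fin 4 → β),
          P.IsQuadCollection w e
      · obtain ⟨m, w, e, hq⟩ := hq
        obtain ⟨r, hr⟩ := hq.exists_patch
        exact ⟨_, .patch P r hs hr⟩
      · push Not at hq
        obtain ⟨f, hf⟩ := exists_branchEdge hP fun c hc => hs c (.reduce c hc)
        exact ⟨_, .branch P f hs hq hf⟩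
  | @fork c d r s _ _ ihc ihd =>
    refine Or.inr ?_
    rcases ihc with rfl | ⟨c', hc'⟩
    · rcases ihd with rfl | ⟨d', hd'⟩
      · exact ⟨_, .join r s⟩
      · exact ⟨_, .second r d d' hd'⟩
    · exact ⟨_, .first c c' d hc'⟩

lemma reflTransGen_value {c c' : Config α β} (h : ReflTransGen Step c c') {r : Option ℝ}
    (hr : c.Value r) : c'.Value r := by
  induction h with
  | refl => exact hr
  | tail _ h ih => exact h.value ih

end Execution

/-! ### Termination. -/

section Termination

variable {α β : Type*} {P P' : Problem α β}

/-- A quantity that decreases whenever the algorithm passes to a new problem. -/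
noncomputable def Problem.size (P : Problem α β) : ℕ :=
  V(P.graph).ncard + E(P.graph).ncard + (E(P.graph) \ P.forced).ncard

lemma Problem.Valid.size_force_lt (hP : P.Valid) {A : Set β} {f : β} (hf : f ∈ E(P.graph))
    (hfA : f ∈ A) (hfF : f ∉ P.forced) : (P.force A).size < P.size := by
  refine Nat.add_lt_add_left (Set.ncard_lt_ncard ?_ hP.finite_edgeSet.sdiff) _
  refine ⟨Set.sdiff_subset_sdiff_right Set.subset_union_left, fun h => ?_⟩
  exact (h ⟨hf, hfF⟩).2 (Or.inr hfA)

lemma Problem.Valid.size_lt (hP : P.Valid) (hV : V(P'.graph).ncard ≤ V(P.graph).ncard)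
    (hE : E(P'.graph) ⊂ E(P.graph)) (hF : E(P'.graph) \ P'.forced ⊆ E(P.graph) \ P.forced) :
    P'.size < P.size := by
  have h1 := Set.ncard_lt_ncard hE hP.finite_edgeSet
  have h2 := Set.ncard_le_ncard hF hP.finite_edgeSet.sdiff
  unfold size
  omega

lemma Problem.Valid.size_delete_lt (hP : P.Valid) {f : β} (hf : f ∈ E(P.graph)) :
    (P.delete f).size < P.size := by
  have hE : E((P.delete f).graph) = E(P.graph) \ {f} := by simp [Problem.delete]
  refine hP.size_lt le_rfl ?_ ?_
  · rw [hE]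
    exact ⟨Set.sdiff_subset, fun h => (h hf).2 rfl⟩
  · rw [hE]
    exact Set.sdiff_subset_sdiff_left Set.sdiff_subset

/-- Steps (b) and (j) turn an unforced edge into a forced one. The others lose an edge and create no
unforced one: contractions reuse labels, so the new edge set is a proper subset of the old. -/
lemma Simplify.size_lt (hP : P.Valid) (h : Simplify P (.call P')) : P'.size < P.size := by
  cases h with
  | reduce _ h =>
    cases h with
    | degreeTwo x hx hd hnew =>
      obtain ⟨f, hf, hfF⟩ := Set.not_subset.1 hnew
      exact hP.size_force_lt (Graph.Inc.edge_mem hf) hf hfF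
    | path x a b e₁ e₂ hne ha hb h₁ h₂ h =>
      refine hP.size_lt ?_ ⟨fun f hf => (mem_edgeSet_contractPath.1 hf).1, fun hh => ?_⟩ ?_
      · rw [vertexSet_contractPath hb h₂]
        exact Set.ncard_le_ncard Set.sdiff_subset hP.finite_vertexSet
      · exact hne ((mem_edgeSet_contractPath.1 (hh h₂.edge_mem)).2 h₂.inc_left).symm
      · rintro f ⟨hf, hfF⟩
        obtain ⟨hf, hfx⟩ := mem_edgeSet_contractPath.1 hf
        -- Only `e₂` ceases to be forced, and it is no longer an edge.
        refine ⟨hf, fun hh => hfF ⟨hh, ?_⟩⟩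
        rintro rfl
        exact hne (hfx h₂.inc_left).symm
    | parallel x y f g hne hf hg hV hfF h => exact hP.size_delete_lt hf.edge_mem
    | loop x f hf hfF hV => exact hP.size_delete_lt hf.edge_mem
  | triangle hno w e h =>
    refine hP.size_lt ?_ ⟨fun f hf => (mem_edgeSet_quotient.1 hf).1, fun hh => ?_⟩ ?_
    · exact Set.ncard_image_le hP.finite_vertexSet
    · exact (mem_edgeSet_quotient.1 (hh (h.2.2 0).edge_mem)).2 ⟨0, rfl⟩
    · rintro f ⟨hf, hfF⟩
      obtain ⟨hf, hfe⟩ := mem_edgeSet_quotient.1 hf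
      exact ⟨hf, fun hh => hfF ⟨Or.inl hh, hfe⟩⟩
  | quad w e h h₀ h₂ hnew =>
    obtain ⟨f, hf, hfF⟩ := Set.not_subset.1 hnew
    exact hP.size_force_lt (P.outerEdges_subset w e hf) hf hfF

lemma acc_ret (r : Option ℝ) : Acc (fun c' c : Config α β => Step c c') (.ret r) :=
  ⟨_, fun _ h => by cases h⟩

/-- A step changes one side and keeps the other, or joins two results; so nested induction on the
two accessibility proofs suffices. -/
lemma acc_fork {c d : Config α β} (hc : Acc (fun c' c : Config α β => Step c c') c)
    (hd : Acc (fun c' c : Config α β => Step c c') d) :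
    Acc (fun c' c : Config α β => Step c c') (.fork c d) := by
  induction hc generalizing d with
  | intro c _ ihc =>
    induction hd with
    | intro d hd ihd =>
      refine ⟨_, fun _ h => ?_⟩
      cases h with
      | first _ c' _ h => exact ihc c' h ⟨_, hd⟩
      | second r _ d' h => exact ihd d' h
      | join r s => exact acc_ret _

/-- The algorithm terminates. -/
lemma Problem.Valid.acc_call (hP : P.Valid) :
    Acc (fun c' c : Config α β => Step c c') (.call P) := by
  induction hn : P.size using Nat.strong_induction_on generalizing P with
  | _ n ih =>
    subst hn
    refine ⟨_, fun c h => ?_⟩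
    cases h with
    | simplify _ _ h =>
      obtain ⟨r, hr⟩ := hP.exists_isOptimum
      -- The value is used here only to learn that the next problem is valid.
      have hval := h.value hP hr
      cases c with
      | call P' =>
        cases hval with
        | call hP' _ => exact ih _ (h.size_lt hP) hP' rfl
      | fork c d => cases h with | reduce _ h => cases h
      | ret r => exact acc_ret r
    | patch _ r _ _ => exact acc_ret r
    | branch _ f _ _ h =>
      obtain ⟨hfE, hfF⟩ := h.mem
      exact acc_fork (ih _ (hP.size_force_lt (A := {f}) hfE rfl hfF)
        (hP.force (by simpa using hfE)) rfl)
        (ih _ (hP.size_delete_lt hfE) (hP.delete hfF) rfl)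

lemma not_exists_seq_of_acc {γ : Type*} {r : γ → γ → Prop} {c : γ}
    (h : Acc (fun c' c => r c c') c) : ¬ ∃ s : ℕ → γ, s 0 = c ∧ ∀ n, r (s n) (s (n + 1)) := by
  induction h with
  | intro c _ ih =>
    rintro ⟨s, rfl, hs⟩
    exact ih (s 1) (hs 0) ⟨fun n => s (n + 1), rfl, fun n => hs (n + 1)⟩

end Termination

end ForcedTSP

theorem mainTheorem1 {α β : Type*} (P : ForcedTSP.Problem α β)
    (hV : V(P.graph).Finite) (hne : V(P.graph).Nonempty) (hE : E(P.graph).Finite)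
    (hdeg : ∀ x ∈ V(P.graph), ForcedTSP.degree P.graph x ≤ 3)
    (hF : P.forced ⊆ E(P.graph)) :
    (¬ ∃ s : ℕ → ForcedTSP.Config α β, s 0 = .call P ∧ ∀ n, ForcedTSP.Step (s n) (s (n + 1))) ∧
    (∀ c, Relation.ReflTransGen ForcedTSP.Step (.call P) c → (∀ c', ¬ ForcedTSP.Step c c') →
      ∃ r, c = .ret r ∧ P.IsOptimum r) := by
  have hP : P.Valid := ⟨hV, hne, hE, hdeg, hF⟩
  refine ⟨ForcedTSP.not_exists_seq_of_acc hP.acc_call, fun c hc hend => ?_⟩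
  obtain ⟨r, hr⟩ := hP.exists_isOptimum
  -- The reached configuration still has the value `r`, so it is either `.ret r` or not stuck.
  rcases (ForcedTSP.reflTransGen_value hc (.call hP hr)).exists_step with rfl | ⟨c', hc'⟩
  · exact ⟨r, rfl, hr⟩
  · exact absurd hc' (hend c')
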